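/- Let $\mathbb{H}$ be the quaternions, regard $\mathbb{H}^{n+1}$ as a right $\mathbb{H}$-vector space, and let $\mathbb{P}^n_{\mathbb{H}}$ be its projective space with the quotient topology. $\mathrm{SL}(n+1,\mathbb{H})$ is the group of quaternionic matrices whose complexification $\begin{bmatrix}A_1&A_2\\-\overline{A_2}&\overline{A_1}\end{bmatrix}$ (for $A=A_1+A_2j$ with $A_1,A_2$ complex) has determinant $1$, and $\mathrm{PSL}(n+1,\mathbb{H})=\mathrm{SL}(n+1,\mathbb{H})/\{\pm I\}$ acts on $\mathbb{P}^n_{\mathbb{H}}$. An element is called parabolic if its lifts are not diagonalizable over $\mathbb{H}$ and all their right eigenvalues ($Av=va$, $v\neq0$) have modulus $1$; it is called loxoparabolic if its lifts are not diagonalizable and have a right eigenvalue of modulus different from $1$. For a subgroup $G$ of $\mathrm{PSL}(n+1,\mathbb{H})$, the region of equicontinuity $\mathrm{Eq}(G)$ is the set of points $z\in\mathbb{P}^n_{\mathbb{H}}$ that have an open neighbourhood $U$ such that every sequence in $\{g|_U: g\in G\}$ has a subsequence converging uniformly on compact subsets of $U$. Write $L\,S$ for the projective subspace spanned by a set $S$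 of points, and $e_1,\dots,e_{n+1}$ for the coordinate points. **Theorem.** Let $\gamma\in\mathrm{PSL}(n+1,\mathbb{H})$ be loxoparabolic with a lift in $\mathrm{SL}(n+1,\mathbb{H})$ of the block-diagonal form $$\gamma=\mathrm{diag}(\lambda_1A_1,\dots,\lambda_kA_k),\qquad |\lambda_1|<|\lambda_2|<\dots<|\lambda_k|,$$ where each $A_i\in\mathrm{SL}(m_i,\mathbb{H})$ is parabolic and $\lambda_i\in\mathbb{H}$ commutes with the entries of $A_i$ (as is automatic if $\lambda_i$ is real, or if $\lambda_i$ and the entries of $A_i$ are complex, for instance if $A_i$ is in Jordan form with complex eigenvalues). Let $\Gamma=\langle\gamma\rangle$, and let $$\Lambda_i=\mathbb{P}^{m_i-1}_{\mathbb{H}}\setminus\mathrm{Eq}(\langle A_i\rangle),$$ regarded as a subset of $\mathbb{P}^n_{\mathbb{H}}$ through the inclusion of the coordinates of the $i$-th block. Then the complement of the region of equicontinuity of $\Gamma$ is a union of two projective subspaces, namely $$\mathbb{P}^n_{\mathbb{H}}\setminus\mathrm{Eq}(\Gamma)=L\big(\Lambda_1\cup\{e_{m_1+1},\dots,e_{n+1}\}\big)\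 \cup\ L\big(\{e_1,\dots,e_{m_1+\dots+m_{k-1}}\}\cup\Lambda_k\big).$$ -/

import Mathlib

open scoped Quaternion LinearAlgebra.Projectivization Topology
open Filter

noncomputable section

namespace QuatProj

section Space

variable (ι : Type*) [Fintype ι]

/-- The quaternionic projective space of the right `ℍ`-vector space `ι → ℍ`
(right multiplication by `α` is the action of `MulOpposite.op α`); for an index set of
cardinality `n + 1` this is the `n`-dimensional quaternionic projective space. -/
abbrev HP : Type _ := ℙ ℍᵐᵒᵖ (ι → ℍ)

/-- The quotient topology. -/
instance HP.instTopologicalSpace : TopologicalSpace (HP ι) :=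
  inferInstanceAs (TopologicalSpace (Quotient (projectivizationSetoid ℍᵐᵒᵖ (ι → ℍ))))

variable {ι}

theorem HP.isQuotientMap_mk' :
    Topology.IsQuotientMap (Projectivization.mk' ℍᵐᵒᵖ : {v : ι → ℍ // v ≠ 0} → HP ι) :=
  isQuotientMap_quotient_mk'

instance HP.instCompactSpace : CompactSpace (HP ι) := by
  let S : Set (ι → ℍ) := Metric.sphere 0 1
  have hne : ∀ v : S, (v : ι → ℍ) ≠ 0 := fun v h => by
    have := v.2
    rw [h] at this
    simp [S] at this
  have hS : CompactSpace S := isCompact_iff_compactSpace.1 (isCompact_sphere _ _)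
  let f : S → HP ι := fun v => Projectivization.mk' ℍᵐᵒᵖ ⟨v, hne v⟩
  have hf : Continuous f :=
    HP.isQuotientMap_mk'.continuous.comp (continuous_subtype_val.subtype_mk hne)
  have hsurj : Function.Surjective f := by
    intro x
    induction x using Projectivization.ind with | h v hv
    have hv0 : ‖v‖ ≠ 0 := norm_ne_zero_iff.2 hv
    refine ⟨⟨(‖v‖⁻¹ : ℝ) • v, ?_⟩, ?_⟩
    · simp [S, norm_smul, hv0]
    · refine (Projectivization.mk_eq_mk_iff' ℍᵐᵒᵖ _ _ _ _).2
        ⟨MulOpposite.op ((‖v‖⁻¹ : ℝ) : ℍ), ?_⟩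
      funext i
      exact Quaternion.mul_coe_eq_smul _ _
  have := isCompact_range hf
  rw [hsurj.range_eq] at this
  exact ⟨this⟩

instance HP.instT2Space : T2Space (HP ι) := by
  let F : {v : ι → ℍ // v ≠ 0} → (ι → ι → ℍ) := fun v i j =>
    (∑ l, Quaternion.normSq (v.1 l))⁻¹ • (v.1 i * star (v.1 j))
  have hpos : ∀ v : {v : ι → ℍ // v ≠ 0}, (∑ l, Quaternion.normSq (v.1 l)) ≠ 0 := by
    intro v h
    apply v.2
    funext i
    have := (Finset.sum_eq_zero_iff_of_nonneg
      (fun l _ => Quaternion.normSq_nonneg (a := v.1 l))).1 h i (Finset.mem_univ i)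
    exact Quaternion.normSq_eq_zero.1 this
  have hFc : Continuous F := by
    have hc : ∀ i, Continuous fun v : {v : ι → ℍ // v ≠ 0} => v.1 i := fun i =>
      (continuous_apply i).comp continuous_subtype_val
    refine continuous_pi fun i => continuous_pi fun j => ?_
    refine Continuous.smul (Continuous.inv₀ ?_ hpos) ((hc i).mul (hc j).star)
    exact continuous_finsetSum _ fun l _ => Quaternion.continuous_normSq.comp (hc l)
  have hF : ∀ (a b : {v : ι → ℍ // v ≠ 0}) (t : ℍᵐᵒᵖ), (a : ι → ℍ) = t • (b : ι → ℍ) →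
      F a = F b := by
    rintro a b t h
    have ht : Quaternion.normSq t.unop ≠ 0 := by
      intro h0
      have h1 : t.unop = 0 := Quaternion.normSq_eq_zero.1 h0
      apply a.2
      rw [h]
      funext i
      simp [MulOpposite.smul_eq_mul_unop, h1]
    have hi : ∀ i, a.1 i = b.1 i * t.unop := fun i => by rw [h]; rfl
    funext i j
    simp only [F, hi, map_mul, star_mul, ← Finset.sum_mul]
    have : b.1 i * t.unop * (star t.unop * star (b.1 j))
        = Quaternion.normSq t.unop • (b.1 i * star (b.1 j)) := by
      rw [mul_assoc, ← mul_assoc t.unop, Quaternion.self_mul_star, ← Quaternion.coe_mul_eq_smul,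
        Quaternion.coe_commutes, Quaternion.coe_commutes, mul_assoc]
    rw [this, smul_smul]
    congr 1
    field_simp
  let G : HP ι → (ι → ι → ℍ) := Projectivization.lift F hF
  have hGc : Continuous G := HP.isQuotientMap_mk'.continuous_iff.2 hFc
  refine T2Space.of_injective_continuous (f := G) ?_ hGc
  intro x y hxy
  induction x using Projectivization.ind with | h v hv
  induction y using Projectivization.ind with | h w hw
  have hxy' : F ⟨v, hv⟩ = F ⟨w, hw⟩ := hxy
  have key : ∀ i, v i = w i * ((∑ l, Quaternion.normSq (w l))⁻¹ • ∑ j, star (w j) * v j) := by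
    intro i
    have h1 : ∑ j, F ⟨v, hv⟩ i j * v j = v i := by
      have : ∀ j, F ⟨v, hv⟩ i j * v j =
          (∑ l, Quaternion.normSq (v l))⁻¹ • (Quaternion.normSq (v j) • v i) := by
        intro j
        simp only [F]
        rw [smul_mul_assoc, mul_assoc, Quaternion.star_mul_self, Quaternion.mul_coe_eq_smul]
      rw [Finset.sum_congr rfl fun j _ => this j, ← Finset.smul_sum, ← Finset.sum_smul, smul_smul,
        inv_mul_cancel₀ (hpos ⟨v, hv⟩), one_smul]
    rw [hxy'] at h1
    rw [← h1, mul_smul_comm, Finset.mul_sum, Finset.smul_sum]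
    refine Finset.sum_congr rfl fun j _ => ?_
    simp only [F]
    rw [smul_mul_assoc, mul_assoc]
  exact (Projectivization.mk_eq_mk_iff' ℍᵐᵒᵖ _ _ _ _).2
    ⟨MulOpposite.op _, funext fun i => (key i).symm⟩

/-- The unique uniform structure of the compact Hausdorff space `HP ι`
(the one of any metric that induces its topology). -/
instance HP.instUniformSpace : UniformSpace (HP ι) := uniformSpaceOfCompactR1

/-- The coordinate point `[0 : ⋯ : 1 : ⋯ : 0]`. -/
def coordPoint [DecidableEq ι] (p : ι) : HP ι :=
  Projectivization.mk ℍᵐᵒᵖ (Pi.single p (1 : ℍ)) (by simp)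

end Space

section Groups

variable {ι : Type*} [Fintype ι] [DecidableEq ι]

/-- For a quaternion `q = z + w j` with `z`, `w` complex: the number `z`. -/
def cpart₁ (q : ℍ) : ℂ := ⟨q.re, q.imI⟩

/-- For a quaternion `q = z + w j` with `z`, `w` complex: the number `w`. -/
def cpart₂ (q : ℍ) : ℂ := ⟨q.imJ, q.imK⟩

/-- The embedding `A₁ + A₂ j ↦ [[A₁, A₂], [-conj A₂, conj A₁]]` into complex matrices. -/
def complexify (A : Matrix ι ι ℍ) : Matrix (ι ⊕ ι) (ι ⊕ ι) ℂ :=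
  Matrix.fromBlocks (A.map cpart₁) (A.map cpart₂)
    (-(A.map cpart₂).map (starRingEnd ℂ)) ((A.map cpart₁).map (starRingEnd ℂ))

theorem cpart₁_sum {α : Type*} (s : Finset α) (f : α → ℍ) :
    cpart₁ (∑ a ∈ s, f a) = ∑ a ∈ s, cpart₁ (f a) :=
  map_sum (⟨⟨cpart₁, rfl⟩, fun _ _ => rfl⟩ : ℍ →+ ℂ) f s

theorem cpart₂_sum {α : Type*} (s : Finset α) (f : α → ℍ) :
    cpart₂ (∑ a ∈ s, f a) = ∑ a ∈ s, cpart₂ (f a) :=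
  map_sum (⟨⟨cpart₂, rfl⟩, fun _ _ => rfl⟩ : ℍ →+ ℂ) f s

theorem cpart₁_mul (p q : ℍ) :
    cpart₁ (p * q) = cpart₁ p * cpart₁ q - cpart₂ p * (starRingEnd ℂ) (cpart₂ q) := by
  apply Complex.ext <;> simp [cpart₁, cpart₂] <;> ring

theorem cpart₂_mul (p q : ℍ) :
    cpart₂ (p * q) = cpart₁ p * cpart₂ q + cpart₂ p * (starRingEnd ℂ) (cpart₁ q) := by
  apply Complex.ext <;> simp [cpart₁, cpart₂] <;> ring

theorem complexify_one : complexify (1 : Matrix ι ι ℍ) = 1 := by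
  have h1 : cpart₁ 1 = 1 := rfl
  have h2 : cpart₂ 1 = 0 := rfl
  have h3 : cpart₁ 0 = 0 := rfl
  have h4 : cpart₂ 0 = 0 := rfl
  have e1 : (1 : Matrix ι ι ℍ).map cpart₁ = 1 := Matrix.map_one _ h3 h1
  have e2 : (1 : Matrix ι ι ℍ).map cpart₂ = 0 := by
    ext1 i j
    by_cases h : i = j <;> simp [h, h2, h4]
  rw [complexify, e1, e2, Matrix.map_one _ (map_zero _) (map_one _),
    Matrix.map_zero _ (map_zero _), neg_zero, Matrix.fromBlocks_one]

theorem complexify_mul (A B : Matrix ι ι ℍ) :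
    complexify (A * B) = complexify A * complexify B := by
  rw [complexify, complexify, complexify, Matrix.fromBlocks_multiply]
  ext (i | i) (j | j)
  all_goals
    simp only [Matrix.fromBlocks_apply₁₁, Matrix.fromBlocks_apply₁₂, Matrix.fromBlocks_apply₂₁,
      Matrix.fromBlocks_apply₂₂, Matrix.map_apply, Matrix.mul_apply, Matrix.add_apply,
      Matrix.neg_apply, cpart₁_sum, cpart₂_sum, cpart₁_mul, cpart₂_mul, map_sum, map_add,
      map_sub, map_mul, Complex.conj_conj, ← Finset.sum_add_distrib, ← Finset.sum_neg_distrib]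
    try exact Finset.sum_congr rfl fun l _ => by ring

/-- The quaternionic determinant. -/
def qdet (A : Matrix ι ι ℍ) : ℂ := (complexify A).det

variable (ι) in
/-- The special linear group over the quaternions. -/
def SL : Subgroup (Matrix.GeneralLinearGroup ι ℍ) where
  carrier := {g | qdet (g : Matrix ι ι ℍ) = 1}
  mul_mem' {a b} ha hb := by
    change qdet _ = 1 at ha hb ⊢
    rw [qdet] at ha hb ⊢
    rw [Units.val_mul, complexify_mul, Matrix.det_mul, ha, hb, one_mul]
  one_mem' := by
    change qdet _ = 1
    rw [qdet, Units.val_one, complexify_one, Matrix.det_one]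
  inv_mem' {a} ha := by
    change qdet _ = 1 at ha ⊢
    rw [qdet] at ha ⊢
    have h : (complexify (a : Matrix ι ι ℍ) * complexify (a⁻¹ : Matrix.GeneralLinearGroup ι ℍ)).det
        = 1 := by
      rw [← complexify_mul, ← Units.val_mul, mul_inv_cancel, Units.val_one, complexify_one,
        Matrix.det_one]
    rwa [Matrix.det_mul, ha, one_mul] at h

/-- The matrix of an element of the special linear group. -/
def mat (g : SL ι) : Matrix ι ι ℍ := ((g : Matrix.GeneralLinearGroup ι ℍ) : Matrix ι ι ℍ)

theorem mat_ext {g h : SL ι} (e : mat g = mat h) : g = h := Subtype.ext (Units.ext e)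

@[simp] theorem mat_mul (g h : SL ι) : mat (g * h) = mat g * mat h := rfl

@[simp] theorem mat_one : mat (1 : SL ι) = 1 := rfl

theorem mat_mul_inv (g : SL ι) : mat g * mat g⁻¹ = 1 := by
  rw [← mat_mul, mul_inv_cancel, mat_one]

variable (ι) in
/-- The subgroup `{1, -1}` of the special linear group, which is its center. -/
def SL.signs : Subgroup (SL ι) where
  carrier := {g | mat g = 1 ∨ mat g = -1}
  mul_mem' {a b} ha hb := by
    change _ ∨ _ at ha hb ⊢
    rcases ha with ha | ha <;> rcases hb with hb | hb <;> simp [ha, hb]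
  one_mem' := Or.inl rfl
  inv_mem' {a} ha := by
    change _ ∨ _ at ha ⊢
    have h := mat_mul_inv a
    rcases ha with ha | ha <;> rw [ha] at h
    · exact Or.inl (by simpa using h)
    · exact Or.inr (by rw [← h]; simp)

instance SL.signs_normal : (SL.signs ι).Normal where
  conj_mem a ha g := by
    change _ ∨ _ at ha ⊢
    rcases ha with ha | ha
    · exact Or.inl (by rw [mat_mul, mat_mul, ha, mul_one, mat_mul_inv g])
    · exact Or.inr (by rw [mat_mul, mat_mul, ha]; simp [mat_mul_inv g])

variable (ι) in
/-- The projective special linear group over the quaternions. -/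
abbrev PSL : Type _ := SL ι ⧸ SL.signs ι

/-- The `ℍ`-linear map `v ↦ A v` of the right `ℍ`-vector space `ι → ℍ`. -/
def mulVecLin (A : Matrix ι ι ℍ) : (ι → ℍ) →ₗ[ℍᵐᵒᵖ] (ι → ℍ) where
  toFun v := A.mulVec v
  map_add' := Matrix.mulVec_add A
  map_smul' := Matrix.mulVec_smul A

theorem mulVecLin_injective (g : SL ι) : Function.Injective (mulVecLin (mat g)) := by
  have h : mat g⁻¹ * mat g = 1 := by rw [← mat_mul, inv_mul_cancel, mat_one]
  intro v w hvw
  change (mat g).mulVec v = (mat g).mulVec w at hvw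
  have := congrArg (mat g⁻¹).mulVec hvw
  rwa [Matrix.mulVec_mulVec, Matrix.mulVec_mulVec, h, Matrix.one_mulVec, Matrix.one_mulVec] at this

/-- The action `g [v] = [g v]` of the special linear group on the projective space. -/
instance SL.instMulAction : MulAction (SL ι) (HP ι) where
  smul g := Projectivization.map (mulVecLin (mat g)) (mulVecLin_injective g)
  one_smul x := by
    induction x using Projectivization.ind with | h v hv
    change Projectivization.mk ℍᵐᵒᵖ ((1 : Matrix ι ι ℍ).mulVec v) _ = _
    congr 1
    exact Matrix.one_mulVec v
  mul_smul g h x := by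
    induction x using Projectivization.ind with | h v hv
    change Projectivization.mk ℍᵐᵒᵖ ((mat g * mat h).mulVec v) _ =
      Projectivization.mk ℍᵐᵒᵖ ((mat g).mulVec ((mat h).mulVec v)) _
    congr 1
    exact (Matrix.mulVec_mulVec v (mat g) (mat h)).symm

theorem SL.smul_mk (g : SL ι) (v : ι → ℍ) (hv : v ≠ 0) :
    g • (Projectivization.mk ℍᵐᵒᵖ v hv : HP ι) =
      Projectivization.mk ℍᵐᵒᵖ ((mat g).mulVec v)
        (map_zero (mulVecLin (mat g)) ▸ (mulVecLin_injective g).ne hv) := rfl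

theorem SL.signs_le_ker : SL.signs ι ≤ (MulAction.toPermHom (SL ι) (HP ι)).ker := by
  intro g hg
  rw [MonoidHom.mem_ker]
  ext x
  induction x using Projectivization.ind with | h v hv
  change g • (Projectivization.mk ℍᵐᵒᵖ v hv : HP ι) = Projectivization.mk ℍᵐᵒᵖ v hv
  rw [SL.smul_mk]
  refine (Projectivization.mk_eq_mk_iff' ℍᵐᵒᵖ _ _ _ _).2 ?_
  rcases hg with hg | hg
  · exact ⟨1, by rw [hg, Matrix.one_mulVec, one_smul]⟩
  · exact ⟨-1, by rw [hg, Matrix.neg_mulVec, Matrix.one_mulVec, neg_smul, one_smul]⟩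

/-- The induced action of the projective special linear group. -/
instance PSL.instMulAction : MulAction (PSL ι) (HP ι) :=
  MulAction.compHom (HP ι)
    (QuotientGroup.lift (SL.signs ι) (MulAction.toPermHom (SL ι) (HP ι)) SL.signs_le_ker)

/-- The class of a lift. -/
def PSL.mk (g : SL ι) : PSL ι := QuotientGroup.mk g

theorem PSL.mk_smul (g : SL ι) (x : HP ι) : PSL.mk g • x = g • x := rfl

/-- Right eigenvalues: `A v = v a` for some nonzero `v`. -/
def IsRightEigenvalue (A : Matrix ι ι ℍ) (a : ℍ) : Prop :=
  ∃ v : ι → ℍ, v ≠ 0 ∧ A.mulVec v = fun i => v i * a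

/-- Semisimple, that is, diagonalizable over the quaternions. -/
def IsSemisimple (A : Matrix ι ι ℍ) : Prop :=
  ∃ S : Matrix.GeneralLinearGroup ι ℍ,
    ((S : Matrix ι ι ℍ) * A * ((S⁻¹ : Matrix.GeneralLinearGroup ι ℍ) : Matrix ι ι ℍ)).IsDiag

/-- Parabolic elements (the two lifts `± g` of an element satisfy the condition together). -/
def IsParabolic (x : PSL ι) : Prop :=
  ∃ g : SL ι, PSL.mk g = x ∧ ¬ IsSemisimple (mat g) ∧ ∀ a, IsRightEigenvalue (mat g) a → ‖a‖ = 1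

/-- Loxoparabolic elements (the two lifts `± g` of an element satisfy the condition together). -/
def IsLoxoparabolic (x : PSL ι) : Prop :=
  ∃ g : SL ι, PSL.mk g = x ∧ ¬ IsSemisimple (mat g) ∧ ∃ a, IsRightEigenvalue (mat g) a ∧ ‖a‖ ≠ 1

/-- A family of maps is normal if each sequence in it has a subsequence that converges uniformly
on compact sets. -/
def IsNormalFamily {X Y : Type*} [TopologicalSpace X] [UniformSpace Y] (F : Set (X → Y)) : Prop :=
  ∀ f : ℕ → X → Y, (∀ m, f m ∈ F) →
    ∃ φ : ℕ → ℕ, StrictMono φ ∧ ∃ g : X → Y,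
      ∀ K : Set X, IsCompact K → TendstoUniformlyOn (fun m => f (φ m)) g atTop K

/-- The region of equicontinuity of a subgroup. -/
def eqRegion (G : Subgroup (PSL ι)) : Set (HP ι) :=
  {z | ∃ U : Set (HP ι), IsOpen U ∧ z ∈ U ∧
    IsNormalFamily {f : U → HP ι | ∃ g ∈ G, f = fun u : U => g • (u : HP ι)}}

end Groups

section Blocks

variable {κ : Type*} [DecidableEq κ] {β : κ → Type*}

/-- The inclusion of the coordinates of block `i`, extended by zero. -/
def blockIncl (i : κ) : (β i → ℍ) →ₗ[ℍᵐᵒᵖ] ((Σ j, β j) → ℍ) where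
  toFun v := fun p => if h : p.1 = i then v (h ▸ p.2) else 0
  map_add' v w := by
    funext p
    by_cases h : p.1 = i <;> simp [h]
  map_smul' a v := by
    funext p
    by_cases h : p.1 = i <;> simp [h]

theorem blockIncl_injective (i : κ) : Function.Injective (blockIncl (β := β) i) := by
  intro v w h
  funext b
  have := congrFun h ⟨i, b⟩
  simpa [blockIncl] using this

/-- The inclusion of the projective space of block `i`. -/
def blockInclP (i : κ) : HP (β i) → HP (Σ j, β j) :=
  Projectivization.map (blockIncl i) (blockIncl_injective i)

end Blocks

end QuatProj

end

namespace QuatProj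

/-! ### Topology of the quotient and joint convergence of the action -/

section ProjectiveTopology

variable {ι : Type*} [Fintype ι]

/-! The region of equicontinuity of a cyclic group is read off from limits of rescaled powers.
Suppose real multiples of matrices `g j` converge to a nonzero matrix `B`. Away from the
projectivized kernel of `B` the maps converge to `[v] ↦ [B v]`, uniformly on compact sets
(`exists_tendstoUniformlyOn`). At a point of the kernel no neighbourhood admits such convergence:
points tending to it can be chosen whose images stay in a prescribed hyperplane, and that hyperplane
can be chosen to miss the value of any continuous limit (`not_tendstoUniformlyOn`). Hence, if all
limits of rescaled powers for `k → -∞` have one kernel `W₁` and all those for `k → +∞` have one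
kernel `W₂`, the complement of the region is the union of the projectivizations of `W₁` and `W₂`
(`eqRegion_zpowers_compl`).

The kernels are found by measuring growth (`HasGrowth`). The complexification of a parabolic block
has only eigenvalues of modulus one, so it is a product of commuting factors `S` and `Q`, where the
powers of `S` are bounded and `u = Q - 1` is nilpotent. If `d` is the largest exponent with `u ^ d ≠
0`, the binomial expansion gives growth of order `|k| ^ d` exactly off the kernel of `u ^ d`
(`HasGrowth.of_unipotent`). As `Q⁻¹ - 1 = -Q⁻¹ u`, this kernel is the same in both directions, so
each `Λ_i` is the projectivization of a single subspace `W i`.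

For `γ` the moduli `‖lam i‖ ^ k` beat the polynomial factors: the last block dominates for `k → +∞`
and the first for `k → -∞` (`HasGrowth.of_dominant`). The limit kernel is then the set of vectors
whose component in the dominant block lies in `W i`, which is the span of `Λ_i` and the coordinate
points of the other blocks (`span_blockInclP_union`). -/

/-- The saturation of `U` is the union, over nonzero scalars `a`, of the preimages of `U` under the
continuous maps `v ↦ v a`. -/
theorem HP.isOpenMap_mk' :
    IsOpenMap (Projectivization.mk' ℍᵐᵒᵖ : {v : ι → ℍ // v ≠ 0} → HP ι) := by
  intro U hU
  rw [← HP.isQuotientMap_mk'.isOpen_preimage]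
  have hpre : Projectivization.mk' ℍᵐᵒᵖ ⁻¹' (Projectivization.mk' ℍᵐᵒᵖ '' U) =
      ⋃ a : ℍˣ, {v : {v : ι → ℍ // v ≠ 0} |
        ∃ h : (fun i => v.1 i * (a : ℍ)) ≠ 0, (⟨fun i => v.1 i * (a : ℍ), h⟩ : {v : ι → ℍ // v ≠ 0}) ∈ U} := by
    ext v
    simp only [Set.mem_preimage, Set.mem_image, Set.mem_iUnion, Set.mem_ofPred_eq]
    constructor
    · rintro ⟨u, hu, huv⟩
      obtain ⟨a, ha⟩ := (Projectivization.mk_eq_mk_iff ℍᵐᵒᵖ _ _ u.2 v.2).1 huv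
      refine ⟨Units.mk0 (a : ℍᵐᵒᵖ).unop ?_, ?_⟩
      · simp
      · have hav : (fun i => v.1 i * (a : ℍᵐᵒᵖ).unop) = u.1 := ha
        have : (fun i => v.1 i * ((Units.mk0 (a : ℍᵐᵒᵖ).unop (by simp) : ℍˣ) : ℍ)) = u.1 := hav
        refine ⟨by rw [this]; exact u.2, ?_⟩
        convert! hu
    · rintro ⟨a, h, hu⟩
      exact ⟨_, hu, (Projectivization.mk_eq_mk_iff' ℍᵐᵒᵖ _ _ h v.2).2
        ⟨MulOpposite.op (a : ℍ), rfl⟩⟩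
  rw [hpre]
  refine isOpen_iUnion fun a => ?_
  have hne : ∀ v : {v : ι → ℍ // v ≠ 0}, (fun i => v.1 i * (a : ℍ)) ≠ 0 := fun v h =>
    v.2 (funext fun i => by simpa using congrFun h i)
  have hc : Continuous fun v : {v : ι → ℍ // v ≠ 0} =>
      (⟨fun i => v.1 i * (a : ℍ), hne v⟩ : {v : ι → ℍ // v ≠ 0}) :=
    Continuous.subtype_mk (continuous_pi fun i =>
      ((continuous_apply i).comp continuous_subtype_val).mul continuous_const) _
  convert! hU.preimage hc using 1
  ext v
  exact ⟨fun ⟨_, h⟩ => h, fun h => ⟨hne v, h⟩⟩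

theorem HP.nhds_mk {v : ι → ℍ} (hv : v ≠ 0) :
    𝓝 (Projectivization.mk ℍᵐᵒᵖ v hv : HP ι) =
      map (Projectivization.mk' ℍᵐᵒᵖ) (𝓝 (⟨v, hv⟩ : {v : ι → ℍ // v ≠ 0})) :=
  (HP.isOpenMap_mk'.map_nhds_eq HP.isQuotientMap_mk'.continuous.continuousAt).symm

theorem HP.mk_real_smul {v : ι → ℍ} (hv : v ≠ 0) {c : ℝ} (hcv : c • v ≠ 0) :
    (Projectivization.mk ℍᵐᵒᵖ (c • v) hcv : HP ι) = Projectivization.mk ℍᵐᵒᵖ v hv := by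
  refine (Projectivization.mk_eq_mk_iff' ℍᵐᵒᵖ _ _ _ _).2 ⟨MulOpposite.op (c : ℍ), ?_⟩
  funext i
  exact Quaternion.mul_coe_eq_smul _ _

theorem HP.tendsto_mk {α : Type*} {l : Filter α} {f : α → ι → ℍ} {v : ι → ℍ}
    (hf : ∀ a, f a ≠ 0) (hv : v ≠ 0) (h : Tendsto f l (𝓝 v)) :
    Tendsto (fun a => (Projectivization.mk ℍᵐᵒᵖ (f a) (hf a) : HP ι)) l
      (𝓝 (Projectivization.mk ℍᵐᵒᵖ v hv)) := by
  have h1 : Tendsto (fun a => (⟨f a, hf a⟩ : {v : ι → ℍ // v ≠ 0})) l (𝓝 ⟨v, hv⟩) :=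
    tendsto_subtype_rng.2 h
  exact (HP.isQuotientMap_mk'.continuous.tendsto _).comp h1

theorem HP.isClosed_projectivization {W : Submodule ℍᵐᵒᵖ (ι → ℍ)}
    (hW : IsClosed (W : Set (ι → ℍ))) : IsClosed (W.projectivization : Set (HP ι)) := by
  rw [← HP.isQuotientMap_mk'.isClosed_preimage]
  exact hW.preimage continuous_subtype_val

variable [DecidableEq ι]

theorem SL.mulVec_ne_zero (g : SL ι) {v : ι → ℍ} (hv : v ≠ 0) : (mat g).mulVec v ≠ 0 :=
  map_zero (mulVecLin (mat g)) ▸ (mulVecLin_injective g).ne hv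

/-- Real factors are invisible in projective space. Convergence is taken jointly in the index and
the point, because this is what yields local uniformity. -/
theorem SL.tendsto_smul_prod {g : ℕ → SL ι} {c : ℕ → ℝ} {B : Matrix ι ι ℍ} (hc : ∀ j, c j ≠ 0)
    (hB : Tendsto (fun j => c j • mat (g j)) atTop (𝓝 B)) {v : ι → ℍ} (hv : v ≠ 0)
    (hBv : B.mulVec v ≠ 0) :
    Tendsto (fun p : ℕ × HP ι => g p.1 • p.2) (atTop ×ˢ 𝓝 (Projectivization.mk ℍᵐᵒᵖ v hv))
      (𝓝 (Projectivization.mk ℍᵐᵒᵖ (B.mulVec v) hBv)) := by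
  rw [HP.nhds_mk, prod_map_right, tendsto_map'_iff]
  have hne : ∀ p : ℕ × {v : ι → ℍ // v ≠ 0}, c p.1 • (mat (g p.1)).mulVec p.2.1 ≠ 0 :=
    fun p => smul_ne_zero (hc _) (SL.mulVec_ne_zero _ p.2.2)
  have hlim : Tendsto (fun p : ℕ × {v : ι → ℍ // v ≠ 0} => c p.1 • (mat (g p.1)).mulVec p.2.1)
      (atTop ×ˢ 𝓝 ⟨v, hv⟩) (𝓝 (B.mulVec v)) := by
    have h1 : Tendsto (fun p : ℕ × {v : ι → ℍ // v ≠ 0} => (c p.1 • mat (g p.1), p.2.1))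
        (atTop ×ˢ 𝓝 ⟨v, hv⟩) (𝓝 (B, v)) := by
      rw [nhds_prod_eq]
      exact (hB.comp tendsto_fst).prodMk
        ((continuous_subtype_val.tendsto (⟨v, hv⟩ : {v : ι → ℍ // v ≠ 0})).comp tendsto_snd)
    have h2 : Continuous fun q : Matrix ι ι ℍ × (ι → ℍ) => q.1.mulVec q.2 :=
      continuous_fst.matrix_mulVec continuous_snd
    refine ((h2.tendsto _).comp h1).congr fun p => ?_
    exact Matrix.smul_mulVec _ _ _
  refine (HP.tendsto_mk hne hBv hlim).congr fun p => ?_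
  rw [HP.mk_real_smul (SL.mulVec_ne_zero _ p.2.2)]
  rfl

theorem SL.continuous_smul (g : SL ι) : Continuous fun x : HP ι => g • x := by
  refine HP.isQuotientMap_mk'.continuous_iff.2 ?_
  have hc : Continuous fun v : {v : ι → ℍ // v ≠ 0} =>
      (⟨(mat g).mulVec v.1, SL.mulVec_ne_zero g v.2⟩ : {v : ι → ℍ // v ≠ 0}) :=
    Continuous.subtype_mk (continuous_const.matrix_mulVec continuous_subtype_val) _
  exact HP.isQuotientMap_mk'.continuous.comp hc

end ProjectiveTopology

/-! ### Normality and kernels of limit matrices -/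

section Normality

variable {ι : Type*} [Fintype ι] [DecidableEq ι]

theorem exists_tendstoUniformlyOn {g : ℕ → SL ι} {c : ℕ → ℝ} {B : Matrix ι ι ℍ}
    (hc : ∀ j, c j ≠ 0) (hB : Tendsto (fun j => c j • mat (g j)) atTop (𝓝 B))
    {U : Set (HP ι)} (hU : ∀ v (hv : v ≠ 0), Projectivization.mk ℍᵐᵒᵖ v hv ∈ U → B.mulVec v ≠ 0) :
    ∃ G : U → HP ι, ∀ K : Set U, IsCompact K →
      TendstoUniformlyOn (fun j (u : U) => g j • (u : HP ι)) G atTop K := by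
  have hrep : ∀ u : U, B.mulVec (u : HP ι).rep ≠ 0 := fun u =>
    hU _ (u : HP ι).rep_nonzero (by rw [Projectivization.mk_rep]; exact u.2)
  obtain ⟨G, hGdef⟩ : ∃ G : U → HP ι,
      ∀ u, G u = Projectivization.mk ℍᵐᵒᵖ (B.mulVec (u : HP ι).rep) (hrep u) := ⟨_, fun _ => rfl⟩
  have key : ∀ u : U, Tendsto (fun p : ℕ × U => g p.1 • (p.2 : HP ι)) (atTop ×ˢ 𝓝 u)
      (𝓝 (G u)) := by
    intro u
    have h : Tendsto (fun p : ℕ × HP ι => g p.1 • p.2) (atTop ×ˢ 𝓝 (u : HP ι)) (𝓝 (G u)) := by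
      have h := SL.tendsto_smul_prod hc hB (u : HP ι).rep_nonzero (hrep u)
      rwa [Projectivization.mk_rep, ← hGdef] at h
    have h2 : Tendsto (fun p : ℕ × U => (p.1, (p.2 : HP ι))) (atTop ×ˢ 𝓝 u)
        (atTop ×ˢ 𝓝 (u : HP ι)) :=
      tendsto_fst.prodMk ((continuous_subtype_val.tendsto u).comp tendsto_snd)
    have h3 := h.comp h2
    simpa only [Function.comp_def] using h3
  have hG : Continuous G := by
    rw [continuous_iff_continuousAt]
    intro u
    -- By joint convergence `g n • y` lies in the closed neighbourhood `V` for `y` near `u` and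
    -- large `n`; letting `n` grow puts `G y` in `V`.
    refine (closed_nhds_basis (G u)).tendsto_right_iff.2 fun V hV => ?_
    have h2 : ∀ᶠ (y : U) in 𝓝 u, ∀ᶠ n in atTop, g n • (y : HP ι) ∈ V :=
      (((key u).comp tendsto_prod_swap).eventually hV.1).curry
    filter_upwards [h2] with y hy
    exact hV.2.mem_of_tendsto ((key y).comp (tendsto_id.prodMk (tendsto_const_nhds))) hy
  refine ⟨G, fun K hK => (tendstoLocallyUniformlyOn_iff_tendstoUniformlyOn_of_compact hK).1 ?_⟩
  rw [tendstoLocallyUniformlyOn_iff_forall_tendsto]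
  intro u _
  have h2 : Tendsto (fun p : ℕ × U => (G p.2, g p.1 • (p.2 : HP ι))) (atTop ×ˢ 𝓝 u)
      (𝓝 (G u, G u)) := by
    rw [nhds_prod_eq]
    exact ((hG.tendsto u).comp tendsto_snd).prodMk (key u)
  exact (h2.mono_left (prod_mono_right _ nhdsWithin_le_nhds)).mono_right (nhds_le_uniformity _)

theorem exists_row_ne_zero {a b : ι → ℍ} (ha : a ≠ 0) (hb : b ≠ 0) :
    ∃ r : ι → ℍ, r ⬝ᵥ a ≠ 0 ∧ r ⬝ᵥ b ≠ 0 := by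
  obtain ⟨i, hi⟩ := Function.ne_iff.1 ha
  obtain ⟨j, hj⟩ := Function.ne_iff.1 hb
  simp only [Pi.zero_apply] at hi hj
  by_cases hbi : b i = 0
  · by_cases haj : a j = 0
    · refine ⟨Pi.single i 1 + Pi.single j 1, ?_, ?_⟩ <;>
        simp [add_dotProduct, hbi, haj, hi, hj]
    · exact ⟨Pi.single j 1, by simpa using haj, by simpa using hj⟩
  · exact ⟨Pi.single i 1, by simpa using hi, by simpa using hbi⟩

/-- Perturb `v` along `w` and solve `r ⬝ᵥ M j (v + w t) = 0` for the right scalar `t`. The factors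
`c j` cancel in the solution, which therefore tends to `-(r B w)⁻¹ (r B v) = 0`. -/
theorem exists_tendsto_mulVec_eq_zero {M : ℕ → Matrix ι ι ℍ} {c : ℕ → ℝ} {B : Matrix ι ι ℍ}
    (hc : ∀ j, c j ≠ 0) (hB : Tendsto (fun j => c j • M j) atTop (𝓝 B)) {v w r : ι → ℍ}
    (hBv : B.mulVec v = 0) (hBw : r ⬝ᵥ B.mulVec w ≠ 0) :
    ∃ z : ℕ → ι → ℍ, Tendsto z atTop (𝓝 v) ∧ ∀ᶠ j in atTop, r ⬝ᵥ (M j).mulVec (z j) = 0 := by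
  have hlim : ∀ x, Tendsto (fun j => c j • (r ⬝ᵥ (M j).mulVec x)) atTop
      (𝓝 (r ⬝ᵥ B.mulVec x)) := by
    intro x
    have h2 : Continuous fun N : Matrix ι ι ℍ => r ⬝ᵥ N.mulVec x :=
      continuous_const.dotProduct (continuous_id.matrix_mulVec continuous_const)
    refine ((h2.tendsto _).comp hB).congr fun j => ?_
    simp [Matrix.smul_mulVec]
  let t : ℕ → ℍ := fun j => -((r ⬝ᵥ (M j).mulVec w)⁻¹ * (r ⬝ᵥ (M j).mulVec v))
  have ht : Tendsto t atTop (𝓝 0) := by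
    have h1 := (((hlim w).inv₀ hBw).mul (hlim v)).neg
    rw [hBv, dotProduct_zero, mul_zero, neg_zero] at h1
    refine h1.congr fun j => ?_
    have hcj : ((c j : ℝ) : ℍ) ≠ 0 := fun h => hc j (by simpa using congrArg (fun q : ℍ => q.re) h)
    simp only [t, ← Quaternion.coe_mul_eq_smul, mul_inv_rev]
    rw [mul_assoc, inv_mul_cancel_left₀ hcj]
  refine ⟨fun j => v + fun i => w i * t j, ?_, ?_⟩
  · have h1 : Tendsto (fun j => fun i => w i * t j) atTop (𝓝 (0 : ι → ℍ)) := by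
      rw [tendsto_pi_nhds]
      intro i
      simpa using ht.const_mul (w i)
    simpa using h1.const_add v
  · have hne : ∀ᶠ j in atTop, c j • (r ⬝ᵥ (M j).mulVec w) ≠ 0 := (hlim w).eventually_ne hBw
    filter_upwards [hne] with j hj
    have hw : r ⬝ᵥ (M j).mulVec w ≠ 0 := right_ne_zero_of_smul hj
    have h1 : (fun i => w i * t j) = MulOpposite.op (t j) • w := rfl
    rw [h1, Matrix.mulVec_add, Matrix.mulVec_smul, dotProduct_add, dotProduct_smul,
      MulOpposite.smul_eq_mul_unop, MulOpposite.unop_op]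
    simp only [t]
    rw [mul_neg, mul_inv_cancel_left₀ hw, add_neg_cancel]

/-- A locally uniform limit `G` is continuous, so images of points tending to `x` tend to `G x`.
Points `z j` tending to `x` with images in the hyperplane `r = 0` force `G x` into that closed
hyperplane, against the choice of `r`. -/
theorem not_tendstoUniformlyOn {g : ℕ → SL ι} {c : ℕ → ℝ} {B : Matrix ι ι ℍ}
    (hc : ∀ j, c j ≠ 0) (hB : Tendsto (fun j => c j • mat (g j)) atTop (𝓝 B)) (hB0 : B ≠ 0)
    {v : ι → ℍ} (hv : v ≠ 0) (hBv : B.mulVec v = 0) {U : Set (HP ι)} (hU : IsOpen U)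
    (hvU : Projectivization.mk ℍᵐᵒᵖ v hv ∈ U) (G : U → HP ι) :
    ¬ ∀ K : Set U, IsCompact K →
      TendstoUniformlyOn (fun j (u : U) => g j • (u : HP ι)) G atTop K := by
  intro h
  have : LocallyCompactSpace U := hU.locallyCompactSpace
  have hlu := tendstoLocallyUniformly_iff_forall_isCompact.2 h
  have hG : Continuous G := hlu.continuous (Frequently.of_forall fun j =>
    (SL.continuous_smul (g j)).comp continuous_subtype_val)
  let x : U := ⟨_, hvU⟩
  obtain ⟨w, hw⟩ : ∃ w, B.mulVec w ≠ 0 := by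
    by_contra! hcon
    exact hB0 (Matrix.ext_of_mulVec_single fun i => by rw [hcon, Matrix.zero_mulVec])
  obtain ⟨r, hr1, hr2⟩ := exists_row_ne_zero hw (G x).rep_nonzero
  obtain ⟨z, hz, hrz⟩ := exists_tendsto_mulVec_eq_zero hc hB hBv hr1
  have hz0 : ∀ᶠ j in atTop, z j ≠ 0 := hz.eventually_ne hv
  -- The default value `v` is taken for only finitely many `j`, as `z j` tends to `v ≠ 0`; likewise
  -- for the default `x` in `y`.
  let z' : ℕ → {v : ι → ℍ // v ≠ 0} := fun j => by
    classical exact if h : z j ≠ 0 then ⟨z j, h⟩ else ⟨v, hv⟩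
  have hz'eq : ∀ᶠ j in atTop, (z' j).1 = z j := by
    filter_upwards [hz0] with j hj
    simp [z', hj]
  have hz' : Tendsto (fun j => (z' j).1) atTop (𝓝 v) :=
    hz.congr' (hz'eq.mono fun j hj => hj.symm)
  have hmk := HP.tendsto_mk (fun j => (z' j).2) hv hz'
  have hmem := hmk.eventually (hU.mem_nhds hvU)
  let y : ℕ → U := fun j => by
    classical exact if h : Projectivization.mk ℍᵐᵒᵖ (z' j).1 (z' j).2 ∈ U then ⟨_, h⟩ else x
  have hyeq : ∀ᶠ j in atTop, (y j : HP ι) = Projectivization.mk ℍᵐᵒᵖ (z' j).1 (z' j).2 := by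
    filter_upwards [hmem] with j hj
    exact congrArg Subtype.val (dif_pos hj)
  have hy : Tendsto y atTop (𝓝 x) :=
    tendsto_subtype_rng.2 (hmk.congr' (hyeq.mono fun j hj => hj.symm))
  have hlim := hlu.tendsto_comp hG.continuousAt hy
  let W : Submodule ℍᵐᵒᵖ (ι → ℍ) :=
    { carrier := {u | r ⬝ᵥ u = 0}
      add_mem' := fun {a b} ha hb => by
        simp only [Set.mem_ofPred_eq] at *
        rw [dotProduct_add, ha, hb, add_zero]
      zero_mem' := dotProduct_zero r
      smul_mem' := fun a b hb => by
        simp only [Set.mem_ofPred_eq] at *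
        rw [dotProduct_smul, hb, smul_zero] }
  have hWc : IsClosed (W : Set (ι → ℍ)) :=
    isClosed_eq (continuous_const.dotProduct continuous_id) continuous_const
  have hGW := (HP.isClosed_projectivization hWc).mem_of_tendsto hlim (by
    filter_upwards [hyeq, hz'eq, hrz] with j h1 h2 h3
    rw [h1]
    change (mat (g j)).mulVec (z' j).1 ∈ W
    rw [h2]
    exact h3)
  rw [← Projectivization.mk_rep (G x)] at hGW
  exact hr2 hGW

/-- Along the filter `l`, the matrices `M k` have, after rescaling and passing to subsequences,
nonzero limits, and all these limits have kernel `W`. -/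
def HasLimitKernel (l : Filter ℤ) (M : ℤ → Matrix ι ι ℍ) (W : Submodule ℍᵐᵒᵖ (ι → ℍ)) : Prop :=
  W ≠ ⊤ ∧ ∀ k : ℕ → ℤ, Tendsto k atTop l → ∃ φ : ℕ → ℕ, StrictMono φ ∧
    ∃ (c : ℕ → ℝ) (B : Matrix ι ι ℍ), (∀ j, c j ≠ 0) ∧
      Tendsto (fun j => c j • M (k (φ j))) atTop (𝓝 B) ∧ ∀ v, B.mulVec v = 0 ↔ v ∈ W

theorem HasLimitKernel.isClosed {l : Filter ℤ} [l.NeBot] [l.IsCountablyGenerated]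
    {M : ℤ → Matrix ι ι ℍ} {W : Submodule ℍᵐᵒᵖ (ι → ℍ)} (h : HasLimitKernel l M W) :
    IsClosed (W : Set (ι → ℍ)) := by
  obtain ⟨k, hk⟩ := exists_seq_tendsto l
  obtain ⟨φ, -, c, B, -, -, hB⟩ := h.2 k hk
  have : (W : Set (ι → ℍ)) = {v | B.mulVec v = 0} := by ext v; exact (hB v).symm
  rw [this]
  exact isClosed_eq (continuous_const.matrix_mulVec continuous_id) continuous_const

theorem HasLimitKernel.not_mem_eqRegion {l : Filter ℤ} [l.NeBot] [l.IsCountablyGenerated]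
    {g : SL ι} {W : Submodule ℍᵐᵒᵖ (ι → ℍ)} (h : HasLimitKernel l (fun k => mat (g ^ k)) W)
    {x : HP ι} (hx : x ∈ W.projectivization) :
    x ∉ eqRegion (Subgroup.zpowers (PSL.mk g)) := by
  rintro ⟨U, hU, hxU, hN⟩
  obtain ⟨k, hk⟩ := exists_seq_tendsto l
  obtain ⟨φ, hφ, c, B, hc, hB, hBW⟩ := h.2 k hk
  obtain ⟨ψ, hψ, G, hG⟩ := hN (fun j (u : U) => (g ^ k (φ j)) • (u : HP ι)) fun j =>
    ⟨PSL.mk (g ^ k (φ j)), ⟨k (φ j), rfl⟩, rfl⟩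
  induction x using Projectivization.ind with | h v hv
  refine not_tendstoUniformlyOn (g := fun j => g ^ k (φ (ψ j))) (fun j => hc (ψ j))
    (hB.comp hψ.tendsto_atTop) ?_ hv ((hBW v).2 hx) hU hxU G hG
  rintro rfl
  exact h.1 (Submodule.eq_top_iff'.2 fun v => (hBW v).1 (Matrix.zero_mulVec v))

/-- Either some value recurs infinitely often, or the sequence leaves every finite set; in the
latter case a subsequence, chosen by the sign of its terms if need be, goes to one end of `ℤ`. -/
theorem exists_subseq_tendsto_int (k : ℕ → ℤ) : ∃ φ : ℕ → ℕ, StrictMono φ ∧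
    ((∃ a, ∀ j, k (φ j) = a) ∨ Tendsto (k ∘ φ) atTop atTop ∨ Tendsto (k ∘ φ) atTop atBot) := by
  by_cases h1 : Tendsto k atTop cofinite
  · rw [Int.cofinite_eq] at h1
    by_cases h2 : ∃ᶠ j in atTop, 0 ≤ k j
    · obtain ⟨φ, hφ, h3⟩ := extraction_of_frequently_atTop h2
      refine ⟨φ, hφ, Or.inr (Or.inl ?_)⟩
      have h4 : Tendsto (k ∘ φ) atTop (atBot ⊔ atTop) := h1.comp hφ.tendsto_atTop
      rw [tendsto_atTop]
      intro b
      have : {a : ℤ | a < 0 ∨ b ≤ a} ∈ (atBot ⊔ atTop : Filter ℤ) :=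
        mem_sup.2 ⟨(eventually_lt_atBot 0).mono fun a ha => Or.inl ha,
          (eventually_ge_atTop b).mono fun a ha => Or.inr ha⟩
      filter_upwards [h4 this] with j hj
      rcases hj with hj | hj
      · exact absurd (h3 j) (not_le.2 hj)
      · exact hj
    · rw [not_frequently] at h2
      refine ⟨id, strictMono_id, Or.inr (Or.inr ?_)⟩
      rw [tendsto_atBot]
      intro b
      have : {a : ℤ | 0 ≤ a ∨ a ≤ b} ∈ (atBot ⊔ atTop : Filter ℤ) :=
        mem_sup.2 ⟨(eventually_le_atBot b).mono fun a ha => Or.inr ha,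
          (eventually_ge_atTop 0).mono fun a ha => Or.inl ha⟩
      filter_upwards [h1 this, h2] with j hj hj2
      rcases hj with hj | hj
      · exact absurd hj hj2
      · exact hj
  · rw [Tendsto, le_cofinite_iff_compl_singleton_mem] at h1
    push Not at h1
    obtain ⟨a, ha⟩ := h1
    have ha' : ∃ᶠ j in atTop, k j = a := ha
    obtain ⟨φ, hφ, h3⟩ := extraction_of_frequently_atTop ha'
    exact ⟨φ, hφ, Or.inl ⟨a, h3⟩⟩

/-- The whole complement of the two subspaces serves as the neighbourhood `U` of each of its points:
it avoids both kernels, and a constant sequence of powers converges trivially. -/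
theorem eqRegion_zpowers_compl {g : SL ι} {W₁ W₂ : Submodule ℍᵐᵒᵖ (ι → ℍ)}
    (h₁ : HasLimitKernel atBot (fun k => mat (g ^ k)) W₁)
    (h₂ : HasLimitKernel atTop (fun k => mat (g ^ k)) W₂) :
    (eqRegion (Subgroup.zpowers (PSL.mk g)))ᶜ =
      (W₁.projectivization : Set (HP ι)) ∪ W₂.projectivization := by
  refine Set.Subset.antisymm ?_ (Set.union_subset (fun x hx => h₁.not_mem_eqRegion hx)
    fun x hx => h₂.not_mem_eqRegion hx)
  rw [Set.compl_subset_comm]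
  intro x hx
  set U : Set (HP ι) := ((W₁.projectivization : Set (HP ι)) ∪ W₂.projectivization)ᶜ with hUdef
  have hU1 : ∀ v (hv : v ≠ 0), (Projectivization.mk ℍᵐᵒᵖ v hv : HP ι) ∈ U → v ∉ W₁ :=
    fun v hv h hvW => h (Or.inl hvW)
  have hU2 : ∀ v (hv : v ≠ 0), (Projectivization.mk ℍᵐᵒᵖ v hv : HP ι) ∈ U → v ∉ W₂ :=
    fun v hv h hvW => h (Or.inr hvW)
  refine ⟨U, ((HP.isClosed_projectivization h₁.isClosed).union
    (HP.isClosed_projectivization h₂.isClosed)).isOpen_compl, hx, ?_⟩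
  intro f hf
  have hf' : ∀ j, ∃ k : ℤ, f j = fun u : U => (g ^ k) • (u : HP ι) := by
    intro j
    obtain ⟨_, ⟨k, rfl⟩, hk⟩ := hf j
    exact ⟨k, hk⟩
  choose k hk using hf'
  have aux : ∀ (l : Filter ℤ) (W : Submodule ℍᵐᵒᵖ (ι → ℍ)),
      HasLimitKernel l (fun k => mat (g ^ k)) W →
      (∀ v (hv : v ≠ 0), (Projectivization.mk ℍᵐᵒᵖ v hv : HP ι) ∈ U → v ∉ W) →
      ∀ φ : ℕ → ℕ, StrictMono φ → Tendsto (k ∘ φ) atTop l →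
      ∃ φ : ℕ → ℕ, StrictMono φ ∧ ∃ G : U → HP ι,
        ∀ K : Set U, IsCompact K → TendstoUniformlyOn (fun m => f (φ m)) G atTop K := by
    intro l W hW hUW φ hφ hl
    obtain ⟨ψ, hψ, c, B, hc, hB, hBW⟩ := hW.2 _ hl
    obtain ⟨G, hG⟩ := exists_tendstoUniformlyOn (g := fun j => g ^ k (φ (ψ j))) hc hB (U := U)
      fun v hv hvU h0 => hUW v hv hvU ((hBW v).1 h0)
    refine ⟨φ ∘ ψ, hφ.comp hψ, G, fun K hK => ?_⟩
    simpa only [Function.comp, hk] using hG K hK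
  obtain ⟨φ, hφ, h⟩ := exists_subseq_tendsto_int k
  rcases h with ⟨a, ha⟩ | h | h
  · refine ⟨φ, hφ, fun u => (g ^ a) • (u : HP ι), fun K _ => ?_⟩
    simp only [hk, ha]
    exact fun s hs => Eventually.of_forall fun _ u _ => refl_mem_uniformity hs
  · exact aux _ _ h₂ hU2 φ hφ h
  · exact aux _ _ h₁ hU1 φ hφ h

end Normality

/-! ### Growth rates and the limit kernels they determine -/

section Growth

/-- Along `l`, the maps `T k` grow at most at the rate `ρ`, exactly at this rate at points outside
`W`, and at a smaller rate at points of `W`. -/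
structure HasGrowth {α E : Type*} [NormedAddCommGroup E] (l : Filter α) (T : α → E → E)
    (ρ : α → ℝ) (W : Set E) : Prop where
  pos : ∀ k, 0 < ρ k
  bounded : ∀ v, ∃ C : ℝ, ∀ᶠ k in l, ‖T k v‖ ≤ C * ρ k
  small : ∀ v ∈ W, Tendsto (fun k => ‖T k v‖ / ρ k) l (𝓝 0)
  large : ∀ v ∉ W, ∃ c : ℝ, 0 < c ∧ ∀ᶠ k in l, c * ρ k ≤ ‖T k v‖

theorem hasGrowth_map {α β E : Type*} [NormedAddCommGroup E] {l : Filter β} {e : β → α}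
    {T : α → E → E} {ρ : α → ℝ} {W : Set E} (hρ : ∀ k, 0 < ρ k)
    (h : HasGrowth l (fun k => T (e k)) (fun k => ρ (e k)) W) : HasGrowth (map e l) T ρ W where
  pos := hρ
  bounded v := h.bounded v
  small v hv := tendsto_map'_iff.2 (h.small v hv)
  large v hv := h.large v hv

section Subsequences

variable {ι : Type*} [Fintype ι]

/-- Bounds on the images of the basis vectors keep `ρ⁻¹ M` in a ball, so a subsequence converges.
The norm `‖B v‖` is the limit of `‖M v‖ / ρ`, which vanishes exactly on `W`. -/
theorem HasGrowth.exists_subseq {l : Filter ℤ} {M : ℤ → Matrix ι ι ℍ} {ρ : ℤ → ℝ}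
    {W : Set (ι → ℍ)} (h : HasGrowth l (fun k v => (M k).mulVec v) ρ W) (k : ℕ → ℤ)
    (hk : Tendsto k atTop l) : ∃ φ : ℕ → ℕ, StrictMono φ ∧
      ∃ (c : ℕ → ℝ) (B : Matrix ι ι ℍ), (∀ j, c j ≠ 0) ∧
      Tendsto (fun j => c j • M (k (φ j))) atTop (𝓝 B) ∧ ∀ v, B.mulVec v = 0 ↔ v ∈ W := by
  classical
  let x : ℕ → ι → ι → ℍ := fun j => (ρ (k j))⁻¹ • M (k j)
  choose C hC using fun q => h.bounded (Pi.single q (1 : ℍ))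
  have hx : ∀ᶠ j in atTop, x j ∈ Metric.closedBall (0 : ι → ι → ℍ) (∑ q, |C q|) := by
    filter_upwards [hk.eventually (eventually_all.2 hC)] with j hj
    have h0 : 0 ≤ ∑ q, |C q| := Finset.sum_nonneg fun q _ => abs_nonneg _
    rw [mem_closedBall_zero_iff, pi_norm_le_iff_of_nonneg h0]
    intro p
    rw [pi_norm_le_iff_of_nonneg h0]
    intro q
    have h1 := (norm_le_pi_norm _ p).trans (hj q)
    rw [Matrix.mulVec_single_one] at h1
    have h2 : ‖x j p q‖ ≤ C q := by
      change ‖(ρ (k j))⁻¹ • M (k j) p q‖ ≤ C q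
      rw [norm_smul, Real.norm_of_nonneg (inv_nonneg.2 (h.pos _).le), inv_mul_le_iff₀ (h.pos _),
        mul_comm]
      exact h1
    exact h2.trans ((le_abs_self _).trans
      (Finset.single_le_sum (f := fun q => |C q|) (fun q _ => abs_nonneg _) (Finset.mem_univ q)))
  obtain ⟨B, -, φ, hφ, hB⟩ :=
    tendsto_subseq_of_frequently_bounded Metric.isBounded_closedBall hx.frequently
  have hB' : Tendsto (fun j => (ρ (k (φ j)))⁻¹ • M (k (φ j))) atTop (𝓝 (B : Matrix ι ι ℍ)) := hB
  have hkφ := hk.comp hφ.tendsto_atTop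
  refine ⟨φ, hφ, fun j => (ρ (k (φ j)))⁻¹, B, fun j => inv_ne_zero (h.pos _).ne', hB', ?_⟩
  intro v
  have hc : Continuous fun N : Matrix ι ι ℍ => ‖N.mulVec v‖ :=
    (continuous_id.matrix_mulVec continuous_const).norm
  have hv : Tendsto (fun j => ‖(M (k (φ j))).mulVec v‖ / ρ (k (φ j))) atTop
      (𝓝 ‖Matrix.mulVec B v‖) := by
    refine ((hc.tendsto _).comp hB').congr fun j => ?_
    simp only [Function.comp]
    rw [Matrix.smul_mulVec, norm_smul, Real.norm_of_nonneg (inv_nonneg.2 (h.pos _).le),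
      div_eq_inv_mul]
  by_cases hvW : v ∈ W
  · have := tendsto_nhds_unique hv ((h.small v hvW).comp hkφ)
    exact ⟨fun _ => hvW, fun _ => norm_eq_zero.1 this⟩
  · obtain ⟨c, hc0, hcv⟩ := h.large v hvW
    have h1 : c ≤ ‖Matrix.mulVec B v‖ := by
      refine ge_of_tendsto hv ?_
      filter_upwards [hkφ.eventually hcv] with j hj
      rwa [le_div_iff₀ (h.pos _)]
    refine ⟨fun h0 => ?_, fun h0 => absurd h0 hvW⟩
    rw [h0, norm_zero] at h1
    exact absurd h1 (not_le.2 hc0)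

/-- Being the kernel of a limit matrix, `W` is automatically quaternionic-linear. This recovers the
`ℍ`-structure of a set that was found in complex coordinates. -/
theorem HasGrowth.exists_submodule {l : Filter ℤ} [l.NeBot] [l.IsCountablyGenerated]
    {M : ℤ → Matrix ι ι ℍ} {ρ : ℤ → ℝ} {W : Set (ι → ℍ)}
    (h : HasGrowth l (fun k v => (M k).mulVec v) ρ W) :
    ∃ W' : Submodule ℍᵐᵒᵖ (ι → ℍ), (W' : Set (ι → ℍ)) = W := by
  obtain ⟨k, hk⟩ := exists_seq_tendsto l
  obtain ⟨φ, -, c, B, -, -, hB⟩ := h.exists_subseq k hk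
  refine ⟨LinearMap.ker (mulVecLin B), ?_⟩
  ext v
  exact hB v

variable [DecidableEq ι]

theorem HasGrowth.hasLimitKernel {l : Filter ℤ} {M : ℤ → Matrix ι ι ℍ} {ρ : ℤ → ℝ}
    {W : Submodule ℍᵐᵒᵖ (ι → ℍ)} (hW : W ≠ ⊤)
    (h : HasGrowth l (fun k v => (M k).mulVec v) ρ (W : Set (ι → ℍ))) : HasLimitKernel l M W :=
  ⟨hW, h.exists_subseq⟩

end Subsequences

/-! ### Powers of a bounded factor times a unipotent one -/

section Unipotent

variable {V : Type*} [NormedAddCommGroup V] [NormedSpace ℂ V]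

theorem one_add_pow_apply {u : Module.End ℂ V} {d : ℕ} (hu : u ^ (d + 1) = 0) (k : ℕ) (x : V) :
    ((1 + u) ^ k) x = ∑ m ∈ Finset.range d, (k.choose m : ℂ) • (u ^ m) x
      + (k.choose d : ℂ) • (u ^ d) x := by
  have h1 : (1 + u) ^ k = ∑ m ∈ Finset.range (d + 1), (k.choose m : ℂ) • u ^ m := by
    rw [add_comm, (Commute.one_right u).add_pow]
    have e : ∀ m ∈ Finset.range (k + 1), u ^ m * 1 ^ (k - m) * (k.choose m : Module.End ℂ V) =
        (k.choose m : ℂ) • u ^ m := by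
      intro m _
      rw [one_pow, mul_one, ← nsmul_eq_mul', Nat.cast_smul_eq_nsmul]
    rw [Finset.sum_congr rfl e]
    -- Both ranges are enlarged to a common one: the added terms vanish through the binomial
    -- coefficient for `m > k`, and through `u ^ m` for `m > d`.
    have h2 : ∀ N, (∀ m, N ≤ m → (k.choose m : ℂ) • u ^ m = 0) →
        ∑ m ∈ Finset.range N, (k.choose m : ℂ) • u ^ m =
          ∑ m ∈ Finset.range (k + d + 2 + N), (k.choose m : ℂ) • u ^ m := by
      intro N hN
      refine Finset.sum_subset (Finset.range_subset_range.2 (by omega)) fun m _ hm => hN m ?_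
      simpa using hm
    have hz : ∀ N, k + d + 2 ≤ N → ∑ m ∈ Finset.range N, (k.choose m : ℂ) • u ^ m =
        ∑ m ∈ Finset.range (k + d + 2), (k.choose m : ℂ) • u ^ m := by
      intro N hN
      refine (Finset.sum_subset (Finset.range_subset_range.2 hN) fun m _ hm => ?_).symm
      rw [Nat.choose_eq_zero_of_lt (by simp at hm; omega)]
      simp
    rw [h2 (k + 1) fun m hm => by rw [Nat.choose_eq_zero_of_lt (by omega)]; simp,
      h2 (d + 1) fun m hm => by rw [pow_eq_zero_of_le hm hu, smul_zero], hz (k + d + 2 + (k + 1)) (by omega),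
      hz (k + d + 2 + (d + 1)) (by omega)]
  rw [h1, Finset.sum_range_succ]
  simp

/-- Positive and negative powers of `S` are bounded by `C`, so `S` changes norms by bounded factors
only. In the binomial expansion of `Q ^ k x` the term with `u ^ d x` has order `k ^ d` unless it
vanishes, and the remainder `R k x` is smaller by a factor of order `1 / k`. -/
theorem HasGrowth.of_unipotent {S Q : (Module.End ℂ V)ˣ} (hSQ : Commute S Q) {d : ℕ}
    (hd : ((Q : Module.End ℂ V) - 1) ^ (d + 1) = 0) {C : ℝ} (hC : 0 < C)
    (hS : ∀ (k : ℤ) (x : V), ‖((S ^ k : (Module.End ℂ V)ˣ) : Module.End ℂ V) x‖ ≤ C * ‖x‖) :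
    HasGrowth atTop (fun (k : ℕ) x => (((S * Q) ^ k : (Module.End ℂ V)ˣ) : Module.End ℂ V) x)
      (fun k => ((k : ℝ) + 1) ^ d) {x | (((Q : Module.End ℂ V) - 1) ^ d) x = 0} := by
  set u : Module.End ℂ V := (Q : Module.End ℂ V) - 1 with hu
  let R : ℕ → V → V := fun k x => ∑ m ∈ Finset.range d, (k.choose m : ℂ) • (u ^ m) x
  let K : V → ℝ := fun x => ∑ m ∈ Finset.range d, ‖(u ^ m) x‖
  have hK : ∀ x, 0 ≤ K x := fun x => Finset.sum_nonneg fun _ _ => norm_nonneg _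
  have hQ : ∀ (k : ℕ) x, ((Q ^ k : (Module.End ℂ V)ˣ) : Module.End ℂ V) x =
      R k x + (k.choose d : ℂ) • (u ^ d) x := by
    intro k x
    rw [← one_add_pow_apply hd, hu, add_sub_cancel, Units.val_pow_eq_pow_val]
  have hT : ∀ (k : ℕ) x, (((S * Q) ^ k : (Module.End ℂ V)ˣ) : Module.End ℂ V) x =
      ((S ^ (k : ℤ) : (Module.End ℂ V)ˣ) : Module.End ℂ V)
        (((Q ^ k : (Module.End ℂ V)ˣ) : Module.End ℂ V) x) := by
    intro k x
    rw [hSQ.mul_pow, Units.val_mul, zpow_natCast]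
    rfl
  have hS' : ∀ (k : ℤ) (x : V), ‖x‖ ≤ C * ‖((S ^ k : (Module.End ℂ V)ˣ) : Module.End ℂ V) x‖ := by
    intro k x
    have h1 := hS (-k) (((S ^ k : (Module.End ℂ V)ˣ) : Module.End ℂ V) x)
    rwa [← Module.End.mul_apply, ← Units.val_mul, zpow_neg, inv_mul_cancel, Units.val_one,
      Module.End.one_apply] at h1
  -- A quotient replaces the exponent `d - 1`, so that `d = 0`, where the sum is empty, needs no
  -- separate case.
  have hR : ∀ (k : ℕ) x, ‖R k x‖ ≤ K x * (((k : ℝ) + 1) ^ d / ((k : ℝ) + 1)) := by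
    intro k x
    refine (norm_sum_le _ _).trans ?_
    rw [Finset.sum_mul]
    refine Finset.sum_le_sum fun m hm => ?_
    rw [norm_smul, mul_comm, Complex.norm_natCast]
    refine mul_le_mul_of_nonneg_left ?_ (norm_nonneg _)
    have hk : (0 : ℝ) < (k : ℝ) + 1 := by positivity
    rw [le_div_iff₀ hk]
    have h1 : (k.choose m : ℝ) ≤ ((k : ℝ) + 1) ^ m := by
      have h2 : k.choose m ≤ (k + 1) ^ m :=
        (Nat.choose_le_pow k m).trans (Nat.pow_le_pow_left (Nat.le_succ k) m)
      exact_mod_cast h2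
    calc (k.choose m : ℝ) * ((k : ℝ) + 1) ≤ ((k : ℝ) + 1) ^ m * ((k : ℝ) + 1) :=
          mul_le_mul_of_nonneg_right h1 hk.le
      _ = ((k : ℝ) + 1) ^ (m + 1) := (pow_succ _ _).symm
      _ ≤ ((k : ℝ) + 1) ^ d := pow_le_pow_right₀ (by linarith [Nat.cast_nonneg (α := ℝ) k])
          (Finset.mem_range.1 hm)
  have hinv : Tendsto (fun k : ℕ => 1 / ((k : ℝ) + 1)) atTop (𝓝 0) :=
    tendsto_one_div_add_atTop_nhds_zero_nat
  refine ⟨fun k => by positivity, fun x => ?_, fun x hx => ?_, fun x hx => ?_⟩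
  · refine ⟨C * (K x + ‖(u ^ d) x‖), Eventually.of_forall fun k => ?_⟩
    have hk : (1 : ℝ) ≤ (k : ℝ) + 1 := by linarith [Nat.cast_nonneg (α := ℝ) k]
    rw [hT, mul_assoc]
    refine (hS _ _).trans (mul_le_mul_of_nonneg_left ?_ hC.le)
    rw [hQ, add_mul]
    refine (norm_add_le _ _).trans (add_le_add ((hR k x).trans ?_) ?_)
    · exact mul_le_mul_of_nonneg_left (div_le_self (by positivity) hk) (hK x)
    · rw [norm_smul, mul_comm, Complex.norm_natCast]
      refine mul_le_mul_of_nonneg_left ?_ (norm_nonneg _)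
      have h2 : k.choose d ≤ (k + 1) ^ d :=
        (Nat.choose_le_pow k d).trans (Nat.pow_le_pow_left (Nat.le_succ k) d)
      exact_mod_cast h2
  · have h1 : Tendsto (fun k : ℕ => C * K x * (1 / ((k : ℝ) + 1))) atTop (𝓝 0) := by
      simpa using hinv.const_mul (C * K x)
    refine squeeze_zero (fun k => by positivity) (fun k => ?_) h1
    have hk : (0 : ℝ) < ((k : ℝ) + 1) ^ d := by positivity
    have hx' : (u ^ d) x = 0 := hx
    rw [div_le_iff₀ hk, hT]
    refine (hS _ _).trans ?_
    rw [hQ, hx', smul_zero, add_zero]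
    calc C * ‖R k x‖ ≤ C * (K x * (((k : ℝ) + 1) ^ d / ((k : ℝ) + 1))) :=
          mul_le_mul_of_nonneg_left (hR k x) hC.le
      _ = _ := by ring
  · have hx' : 0 < ‖(u ^ d) x‖ := norm_pos_iff.2 hx
    -- For `k ≥ 2 d` the binomial coefficient is at least `((k + 1) / 2) ^ d / d!`, which makes the
    -- leading term at least `a (k + 1) ^ d`. Half of `a` is given up to absorb `R k x`, and `C⁻¹`
    -- accounts for `S ^ k`.
    set a : ℝ := ‖(u ^ d) x‖ / (2 ^ d * d.factorial) with ha
    have ha0 : 0 < a := by positivity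
    refine ⟨C⁻¹ * (a / 2), by positivity, ?_⟩
    have h1 : Tendsto (fun k : ℕ => K x * (1 / ((k : ℝ) + 1))) atTop (𝓝 0) := by
      simpa using hinv.const_mul (K x)
    filter_upwards [h1.eventually (ge_mem_nhds (half_pos ha0)), eventually_ge_atTop (2 * d)]
      with k hk1 hk2
    have hk : (0 : ℝ) < ((k : ℝ) + 1) ^ d := by positivity
    have h2 : ‖R k x‖ ≤ a / 2 * ((k : ℝ) + 1) ^ d := by
      refine (hR k x).trans ?_
      calc _ = K x * (1 / ((k : ℝ) + 1)) * ((k : ℝ) + 1) ^ d := by ring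
        _ ≤ _ := mul_le_mul_of_nonneg_right hk1 hk.le
    have h3 : a * ((k : ℝ) + 1) ^ d ≤ ‖(k.choose d : ℂ) • (u ^ d) x‖ := by
      rw [norm_smul, Complex.norm_natCast, ha, div_mul_eq_mul_div, div_le_iff₀ (by positivity)]
      have h4 : (((k : ℝ) + 1) / 2) ^ d ≤ d.factorial * k.choose d := by
        have h5 := Nat.pow_le_choose (α := ℝ) d k
        rw [div_le_iff₀' (by positivity)] at h5
        refine le_trans ?_ h5
        refine pow_le_pow_left₀ (by positivity) ?_ d
        rw [Nat.cast_sub (by omega)]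
        have : (2 * d : ℝ) ≤ k := by exact_mod_cast hk2
        push_cast
        linarith
      rw [div_pow, div_le_iff₀ (by positivity)] at h4
      calc ‖(u ^ d) x‖ * ((k : ℝ) + 1) ^ d
          ≤ ‖(u ^ d) x‖ * (d.factorial * k.choose d * 2 ^ d) :=
            mul_le_mul_of_nonneg_left h4 hx'.le
        _ = _ := by ring
    have h5 : a / 2 * ((k : ℝ) + 1) ^ d ≤ ‖((Q ^ k : (Module.End ℂ V)ˣ) : Module.End ℂ V) x‖ := by
      rw [hQ]
      have h6 := norm_sub_le (R k x + (k.choose d : ℂ) • (u ^ d) x) (R k x)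
      rw [add_sub_cancel_left] at h6
      linarith
    rw [mul_assoc, inv_mul_le_iff₀ hC, hT]
    exact h5.trans (hS' _ _)

end Unipotent

end Growth

/-! ### Endomorphisms with eigenvalues of modulus one -/

section UnitModulus

variable {V : Type*} [NormedAddCommGroup V] [NormedSpace ℂ V] [FiniteDimensional ℂ V]

/-- On an eigenvector the powers of `S` act by unimodular scalars. Sums of eigenvectors exhaust `V`,
so every orbit is bounded, and the uniform boundedness principle gives one constant. -/
theorem exists_bound_zpow_of_iSup_eigenspace {S : (Module.End ℂ V)ˣ}
    (htop : ⨆ μ : ℂ, (S : Module.End ℂ V).eigenspace μ = ⊤)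
    (hev : ∀ μ, (S : Module.End ℂ V).HasEigenvalue μ → ‖μ‖ = 1) :
    ∃ C : ℝ, 0 < C ∧
      ∀ (k : ℤ) (x : V), ‖((S ^ k : (Module.End ℂ V)ˣ) : Module.End ℂ V) x‖ ≤ C * ‖x‖ := by
  have hpt : ∀ x : V, ∃ C : ℝ, ∀ k : ℤ,
      ‖((S ^ k : (Module.End ℂ V)ˣ) : Module.End ℂ V) x‖ ≤ C := by
    intro x
    have hx : x ∈ ⨆ μ : ℂ, (S : Module.End ℂ V).eigenspace μ := htop ▸ Submodule.mem_top
    induction hx using Submodule.iSup_induction' with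
    | mem μ x hx =>
      by_cases hx0 : x = 0
      · exact ⟨0, fun k => by rw [hx0, map_zero, norm_zero]⟩
      have hμ : ‖μ‖ = 1 :=
        hev μ (Module.End.hasEigenvalue_of_hasEigenvector ⟨hx, hx0⟩)
      have hμ0 : μ ≠ 0 := by
        rintro rfl
        simp at hμ
      have hSx : (S : Module.End ℂ V) x = μ • x := Module.End.mem_eigenspace_iff.1 hx
      have hSx' : ((S⁻¹ : (Module.End ℂ V)ˣ) : Module.End ℂ V) x = μ⁻¹ • x := by
        have h1 : ((S⁻¹ : (Module.End ℂ V)ˣ) : Module.End ℂ V) ((S : Module.End ℂ V) x) = x := by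
          rw [← Module.End.mul_apply, Units.inv_mul, Module.End.one_apply]
        rw [hSx, map_smul] at h1
        rw [← h1, smul_smul, inv_mul_cancel₀ hμ0, one_smul, h1]
      have hk : ∀ k : ℤ, ((S ^ k : (Module.End ℂ V)ˣ) : Module.End ℂ V) x = μ ^ k • x := by
        intro k
        induction k using Int.induction_on with
        | zero => simp
        | succ k ih =>
          rw [zpow_add_one, Units.val_mul, Module.End.mul_apply, hSx, map_smul, ih, smul_smul,
            zpow_add_one₀ hμ0, mul_comm]
        | pred k ih =>
          rw [zpow_sub_one, Units.val_mul, Module.End.mul_apply, hSx', map_smul, ih, smul_smul,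
            zpow_sub_one₀ hμ0, mul_comm]
      exact ⟨‖x‖, fun k => by rw [hk, norm_smul, norm_zpow, hμ, one_zpow, one_mul]⟩
    | zero => exact ⟨0, fun k => by rw [map_zero, norm_zero]⟩
    | add x y _ _ hx hy =>
      obtain ⟨C, hC⟩ := hx
      obtain ⟨D, hD⟩ := hy
      exact ⟨C + D, fun k => by
        rw [map_add]
        exact (norm_add_le _ _).trans (add_le_add (hC k) (hD k))⟩
  have : CompleteSpace V := FiniteDimensional.complete ℂ V
  obtain ⟨C, hC⟩ := banach_steinhaus (g := fun k : ℤ =>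
    LinearMap.toContinuousLinearMap ((S ^ k : (Module.End ℂ V)ˣ) : Module.End ℂ V)) hpt
  refine ⟨|C| + 1, by positivity, fun k x => ?_⟩
  refine ((LinearMap.toContinuousLinearMap
    ((S ^ k : (Module.End ℂ V)ˣ) : Module.End ℂ V)).le_opNorm x).trans ?_
  exact mul_le_mul_of_nonneg_right (by linarith [hC k, le_abs_self C]) (norm_nonneg x)

/-- Apply `n` to an eigenvector of `s` as long as the result is nonzero. The last nonzero vector is
still an eigenvector of `s` by commutation, and `n` kills it. -/
theorem hasEigenvalue_add_of_isNilpotent {s n : Module.End ℂ V} (hc : Commute n s)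
    (hn : IsNilpotent n) {μ : ℂ} (hμ : s.HasEigenvalue μ) : (n + s).HasEigenvalue μ := by
  classical
  obtain ⟨v, hv, hv0⟩ := hμ.exists_hasEigenvector
  have hsv : s v = μ • v := Module.End.mem_eigenspace_iff.1 hv
  have hex : ∃ j, (n ^ j) v = 0 := by
    obtain ⟨j, hj⟩ := hn
    exact ⟨j, by rw [hj, LinearMap.zero_apply]⟩
  have hpos : Nat.find hex ≠ 0 := fun h => hv0 (by simpa [h] using Nat.find_spec hex)
  obtain ⟨j, hj⟩ := Nat.exists_eq_succ_of_ne_zero hpos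
  have hj1 : (n ^ j) v ≠ 0 := Nat.find_min hex (by omega)
  have hj2 : (n ^ (j + 1)) v = 0 := by
    have := Nat.find_spec hex
    rwa [hj] at this
  refine Module.End.hasEigenvalue_of_hasEigenvector (x := (n ^ j) v)
    ⟨Module.End.mem_eigenspace_iff.2 ?_, hj1⟩
  rw [LinearMap.add_apply, ← Module.End.mul_apply, ← pow_succ', hj2, zero_add,
    ← Module.End.mul_apply, ← (hc.pow_left j).eq, Module.End.mul_apply, hsv, map_smul]

/-- This is the multiplicative Jordan–Chevalley decomposition: from `F = n + s` take `S = s` and `Q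
= S⁻¹ F = 1 + S⁻¹ n`. Eigenvalues of `s` are eigenvalues of `F`, hence unimodular. -/
theorem exists_units_mul_eq_isNilpotent (F : (Module.End ℂ V)ˣ)
    (hev : ∀ μ, (F : Module.End ℂ V).HasEigenvalue μ → ‖μ‖ = 1) :
    ∃ S Q : (Module.End ℂ V)ˣ, F = S * Q ∧ Commute S Q ∧ IsNilpotent ((Q : Module.End ℂ V) - 1) ∧
      ∃ C : ℝ, 0 < C ∧
        ∀ (k : ℤ) (x : V), ‖((S ^ k : (Module.End ℂ V)ˣ) : Module.End ℂ V) x‖ ≤ C * ‖x‖ := by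
  obtain ⟨n, hn, s, hs, hnil, hss, hf⟩ :=
    Module.End.exists_isNilpotent_isSemisimple (f := (F : Module.End ℂ V))
  have hFn : Commute (F : Module.End ℂ V) n := Algebra.commute_of_mem_adjoin_self hn
  have hns : Commute n s := Algebra.commute_of_mem_adjoin_singleton_of_commute hs hFn.symm
  have hsF : s = F + -n := by rw [hf]; abel
  obtain ⟨S, hS⟩ : IsUnit s := by
    rw [hsF]
    exact hnil.neg.isUnit_add_left_of_commute F.isUnit hFn.symm.neg_left
  have hcFS : Commute F S := by
    refine Units.ext ?_
    rw [Units.val_mul, Units.val_mul, hS]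
    exact Algebra.commute_of_mem_adjoin_self hs
  have hC := exists_bound_zpow_of_iSup_eigenspace (S := S)
    (by rw [hS]; exact hss.iSup_eigenspace_eq_top)
    (fun μ hμ => hev μ (by
      rw [hf]
      rw [hS] at hμ
      exact hasEigenvalue_add_of_isNilpotent hns hnil hμ))
  refine ⟨S, S⁻¹ * F, by group, ?_, ?_, hC⟩
  · exact (Commute.refl S).inv_right.mul_right hcFS.symm
  · have h1 : ((S⁻¹ * F : (Module.End ℂ V)ˣ) : Module.End ℂ V) - 1 =
        ((S⁻¹ : (Module.End ℂ V)ˣ) : Module.End ℂ V) * n := by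
      rw [Units.val_mul, hf, mul_add, ← hS, Units.inv_mul, add_sub_cancel_right]
    rw [h1]
    have h2 : Commute n ((S⁻¹ : (Module.End ℂ V)ˣ) : Module.End ℂ V) := by
      rw [← hS] at hns
      exact hns.units_inv_right
    exact h2.symm.isNilpotent_mul_left hnil

/-- One `W` serves both directions because `Q⁻¹ - 1` is `u` times a unit commuting with `u`, so
their `d`-th powers have the same kernel. -/
theorem exists_hasGrowth_zpow [Nontrivial V] (F : (Module.End ℂ V)ˣ)
    (hev : ∀ μ, (F : Module.End ℂ V).HasEigenvalue μ → ‖μ‖ = 1) :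
    ∃ (d : ℕ) (W : Set V), W ≠ Set.univ ∧
      HasGrowth atTop (fun (k : ℤ) x => ((F ^ k : (Module.End ℂ V)ˣ) : Module.End ℂ V) x)
        (fun k => ((k.natAbs : ℝ) + 1) ^ d) W ∧
      HasGrowth atBot (fun (k : ℤ) x => ((F ^ k : (Module.End ℂ V)ˣ) : Module.End ℂ V) x)
        (fun k => ((k.natAbs : ℝ) + 1) ^ d) W := by
  classical
  obtain ⟨S, Q, hF, hSQ, hnil, C, hC, hS⟩ := exists_units_mul_eq_isNilpotent F hev
  set u : Module.End ℂ V := (Q : Module.End ℂ V) - 1 with hu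
  have hpos : Nat.find hnil ≠ 0 := fun h => one_ne_zero (α := Module.End ℂ V) (by simpa [h] using Nat.find_spec hnil)
  obtain ⟨d, hd⟩ := Nat.exists_eq_succ_of_ne_zero hpos
  have hd1 : u ^ (d + 1) = 0 := by
    have := Nat.find_spec hnil
    rwa [hd] at this
  have hd0 : u ^ d ≠ 0 := Nat.find_min hnil (by omega)
  have hcQ : Commute ((Q⁻¹ : (Module.End ℂ V)ˣ) : Module.End ℂ V) u := by
    have h1 : Commute (Q : Module.End ℂ V) u := (Commute.refl _).sub_right (Commute.one_right _)
    exact h1.units_inv_left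
  have hinv : ((Q⁻¹ : (Module.End ℂ V)ˣ) : Module.End ℂ V) - 1 =
      -((Q⁻¹ : (Module.End ℂ V)ˣ) : Module.End ℂ V) * u := by
    rw [hu, neg_mul, mul_sub, Units.inv_mul, mul_one, neg_sub]
  have hpow : ∀ m, (((Q⁻¹ : (Module.End ℂ V)ˣ) : Module.End ℂ V) - 1) ^ m =
      (-((Q⁻¹ : (Module.End ℂ V)ˣ) : Module.End ℂ V)) ^ m * u ^ m := by
    intro m
    rw [hinv, hcQ.neg_left.mul_pow]
  have hker : ∀ x, ((((Q⁻¹ : (Module.End ℂ V)ˣ) : Module.End ℂ V) - 1) ^ d) x = 0 ↔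
      (u ^ d) x = 0 := by
    intro x
    rw [hpow, Module.End.mul_apply]
    have hun : IsUnit ((-((Q⁻¹ : (Module.End ℂ V)ˣ) : Module.End ℂ V)) ^ d) :=
      (Q⁻¹).isUnit.neg.pow d
    have hinj := ((Module.End.isUnit_iff _).1 hun).1
    exact map_eq_zero_iff _ hinj
  have g1 := HasGrowth.of_unipotent hSQ hd1 hC hS
  have g2 := HasGrowth.of_unipotent (S := S⁻¹) (Q := Q⁻¹) (d := d) hSQ.inv_inv
    (by rw [hpow, hd1, mul_zero]) hC (fun k x => by
      rw [inv_zpow']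
      exact hS _ _)
  have hW : {x | ((((Q⁻¹ : (Module.End ℂ V)ˣ) : Module.End ℂ V) - 1) ^ d) x = 0} =
      {x | (u ^ d) x = 0} := Set.ext hker
  rw [hW] at g2
  have hF' : F⁻¹ = S⁻¹ * Q⁻¹ := by rw [hF, hSQ.eq, mul_inv_rev]
  rw [← hF'] at g2
  rw [← hF] at g1
  refine ⟨d, {x | (u ^ d) x = 0}, fun h => hd0 (LinearMap.ext fun x => ?_), ?_, ?_⟩
  · have : x ∈ {x | (u ^ d) x = 0} := h ▸ Set.mem_univ x
    exact this
  · rw [← Nat.map_cast_int_atTop]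
    refine hasGrowth_map (fun k => by positivity) ?_
    simpa only [zpow_natCast, Int.natAbs_natCast] using g1
  · have hbot : (atBot : Filter ℤ) = map (fun k : ℕ => -(k : ℤ)) atTop := by
      rw [← Filter.map_neg_atTop, ← Nat.map_cast_int_atTop, Filter.map_map]
      rfl
    rw [hbot]
    refine hasGrowth_map (fun k => by positivity) ?_
    simpa only [zpow_neg, zpow_natCast, Int.natAbs_neg, Int.natAbs_natCast, inv_pow] using g2

end UnitModulus

/-! ### Passage between quaternionic and complex coordinates -/

section Transfer

variable {ι : Type*}

/-- The complex coordinates `(z, -conj w)` of a quaternionic vector `z + w j`. -/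
def complexCoord (v : ι → ℍ) : ι ⊕ ι → ℂ :=
  Sum.elim (fun i => cpart₁ (v i)) (fun i => -(starRingEnd ℂ) (cpart₂ (v i)))

theorem complexCoord_injective : Function.Injective (complexCoord (ι := ι)) := by
  intro v w h
  funext i
  have h1 : cpart₁ (v i) = cpart₁ (w i) := congrFun h (Sum.inl i)
  have h2 : cpart₂ (v i) = cpart₂ (w i) :=
    (starRingEnd ℂ).injective (neg_injective (congrFun h (Sum.inr i)))
  rw [Complex.ext_iff] at h1 h2
  exact QuaternionAlgebra.ext h1.1 h1.2 h2.1 h2.2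

theorem complexCoord_surjective : Function.Surjective (complexCoord (ι := ι)) := by
  intro y
  refine ⟨fun i => ⟨(y (Sum.inl i)).re, (y (Sum.inl i)).im, -(y (Sum.inr i)).re,
    (y (Sum.inr i)).im⟩, ?_⟩
  funext a
  rcases a with i | i <;> apply Complex.ext <;> simp [complexCoord, cpart₁, cpart₂]

/-- Since `j μ = conj μ j`, the conjugate in the second coordinate turns right multiplication by `μ`
into a complex scalar multiplication. -/
theorem complexCoord_mul_coe (v : ι → ℍ) (μ : ℂ) :
    complexCoord (fun i => v i * (μ : ℍ)) = μ • complexCoord v := by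
  have h1 : cpart₁ (μ : ℍ) = μ := by apply Complex.ext <;> simp [cpart₁]
  have h2 : cpart₂ (μ : ℍ) = 0 := by apply Complex.ext <;> simp [cpart₂]
  funext a
  rcases a with i | i
  · simp [complexCoord, cpart₁_mul, h1, h2, mul_comm]
  · simp [complexCoord, cpart₂_mul, h1, h2, mul_comm]

theorem norm_cpart₁_le (q : ℍ) : ‖cpart₁ q‖ ≤ ‖q‖ := by
  refine abs_le_of_sq_le_sq' ?_ (norm_nonneg q) |>.2
  rw [Complex.sq_norm, Complex.normSq_apply, sq, ← Quaternion.normSq_eq_norm_mul_self,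
    Quaternion.normSq_def']
  simp only [cpart₁]
  nlinarith [sq_nonneg q.imJ, sq_nonneg q.imK]

theorem norm_cpart₂_le (q : ℍ) : ‖cpart₂ q‖ ≤ ‖q‖ := by
  refine abs_le_of_sq_le_sq' ?_ (norm_nonneg q) |>.2
  rw [Complex.sq_norm, Complex.normSq_apply, sq, ← Quaternion.normSq_eq_norm_mul_self,
    Quaternion.normSq_def']
  simp only [cpart₂]
  nlinarith [sq_nonneg q.re, sq_nonneg q.imI]

theorem norm_le_cpart (q : ℍ) : ‖q‖ ≤ ‖cpart₁ q‖ + ‖cpart₂ q‖ := by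
  refine abs_le_of_sq_le_sq' ?_ (by positivity) |>.2
  have h1 := Complex.sq_norm (cpart₁ q)
  have h2 := Complex.sq_norm (cpart₂ q)
  rw [Complex.normSq_apply] at h1 h2
  have h3 : ‖q‖ ^ 2 = ‖cpart₁ q‖ ^ 2 + ‖cpart₂ q‖ ^ 2 := by
    rw [h1, h2, sq, ← Quaternion.normSq_eq_norm_mul_self, Quaternion.normSq_def']
    simp only [cpart₁, cpart₂]
    ring
  nlinarith [norm_nonneg (cpart₁ q), norm_nonneg (cpart₂ q)]

theorem norm_coeComplex (μ : ℂ) : ‖(μ : ℍ)‖ = ‖μ‖ := by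
  have h1 : cpart₁ (μ : ℍ) = μ := by apply Complex.ext <;> simp [cpart₁]
  have h2 : cpart₂ (μ : ℍ) = 0 := by apply Complex.ext <;> simp [cpart₂]
  have h3 := norm_le_cpart (μ : ℍ)
  have h4 := norm_cpart₁_le (μ : ℍ)
  rw [h1] at h3 h4
  rw [h2, norm_zero, add_zero] at h3
  exact le_antisymm h3 h4

variable [Fintype ι]

theorem norm_complexCoord_le (v : ι → ℍ) : ‖complexCoord v‖ ≤ ‖v‖ := by
  rw [pi_norm_le_iff_of_nonneg (norm_nonneg _)]
  rintro (i | i)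
  · exact (norm_cpart₁_le _).trans (norm_le_pi_norm v i)
  · simp only [complexCoord, Sum.elim_inr, norm_neg, RCLike.norm_conj]
    exact (norm_cpart₂_le _).trans (norm_le_pi_norm v i)

theorem norm_le_complexCoord (v : ι → ℍ) : ‖v‖ ≤ 2 * ‖complexCoord v‖ := by
  rw [pi_norm_le_iff_of_nonneg (by positivity)]
  intro i
  have h1 : ‖cpart₁ (v i)‖ ≤ ‖complexCoord v‖ := norm_le_pi_norm (complexCoord v) (Sum.inl i)
  have h2 := norm_le_pi_norm (complexCoord v) (Sum.inr i)
  simp only [complexCoord, Sum.elim_inr, norm_neg, RCLike.norm_conj] at h2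
  have h3 := norm_le_cpart (v i)
  simp only [complexCoord] at h1 ⊢
  linarith

theorem HasGrowth.of_complexCoord {α : Type*} {l : Filter α} {T : α → (ι → ℍ) → ι → ℍ}
    {T' : α → (ι ⊕ ι → ℂ) → ι ⊕ ι → ℂ} (hT : ∀ k v, complexCoord (T k v) = T' k (complexCoord v))
    {ρ : α → ℝ} {W : Set (ι ⊕ ι → ℂ)} (h : HasGrowth l T' ρ W) :
    HasGrowth l T ρ (complexCoord ⁻¹' W) := by
  have h1 : ∀ k v, ‖T' k (complexCoord v)‖ ≤ ‖T k v‖ := fun k v => hT k v ▸ norm_complexCoord_le _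
  have h2 : ∀ k v, ‖T k v‖ ≤ 2 * ‖T' k (complexCoord v)‖ :=
    fun k v => hT k v ▸ norm_le_complexCoord _
  refine ⟨h.pos, fun v => ?_, fun v hv => ?_, fun v hv => ?_⟩
  · obtain ⟨C, hC⟩ := h.bounded (complexCoord v)
    exact ⟨2 * C, hC.mono fun k hk => (h2 k v).trans (by linarith)⟩
  · have h3 := (h.small _ hv).const_mul 2
    rw [mul_zero] at h3
    refine squeeze_zero (fun k => div_nonneg (norm_nonneg _) (h.pos k).le) (fun k => ?_) h3
    rw [← mul_div_assoc]
    exact div_le_div_of_nonneg_right (h2 k v) (h.pos k).le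
  · obtain ⟨c, hc, hcv⟩ := h.large _ hv
    exact ⟨c, hc, hcv.mono fun k hk => hk.trans (h1 k v)⟩

/-- The coordinates `(z, -conj w)` are the first column of the block form of `z + w j`, so this is
the multiplicativity of complexification read on first columns. -/
theorem complexCoord_mulVec (A : Matrix ι ι ℍ) (v : ι → ℍ) :
    complexCoord (A.mulVec v) = (complexify A).mulVec (complexCoord v) := by
  funext a
  rcases a with i | i
  · simp only [complexCoord, complexify, Sum.elim_inl, Matrix.mulVec, dotProduct,
      Fintype.sum_sum_type, Matrix.fromBlocks_apply₁₁, Matrix.fromBlocks_apply₁₂, Sum.elim_inr,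
      Matrix.map_apply, cpart₁_sum, cpart₁_mul, ← Finset.sum_add_distrib]
    exact Finset.sum_congr rfl fun l _ => by ring
  · simp only [complexCoord, complexify, Sum.elim_inl, Matrix.mulVec, dotProduct,
      Fintype.sum_sum_type, Matrix.fromBlocks_apply₂₁, Matrix.fromBlocks_apply₂₂, Sum.elim_inr,
      Matrix.map_apply, Matrix.neg_apply, cpart₂_sum, cpart₂_mul, map_sum, map_add, map_mul,
      Complex.conj_conj, ← Finset.sum_add_distrib, ← Finset.sum_neg_distrib]
    exact Finset.sum_congr rfl fun l _ => by ring

variable [DecidableEq ι]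

variable (ι) in
/-- The complexification of quaternionic matrices, with values in the complex endomorphisms. -/
def complexifyHom : Matrix ι ι ℍ →* Module.End ℂ (ι ⊕ ι → ℂ) where
  toFun A := Matrix.toLin' (complexify A)
  map_one' := by rw [complexify_one, Matrix.toLin'_one]; rfl
  map_mul' A B := by rw [complexify_mul, Matrix.toLin'_mul]; rfl

theorem isRightEigenvalue_of_hasEigenvalue {A : Matrix ι ι ℍ} {μ : ℂ}
    (h : (complexifyHom ι A).HasEigenvalue μ) : IsRightEigenvalue A (μ : ℍ) := by
  obtain ⟨y, hy, hy0⟩ := h.exists_hasEigenvector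
  obtain ⟨v, rfl⟩ := complexCoord_surjective y
  have h1 : (complexify A).mulVec (complexCoord v) = μ • complexCoord v :=
    Module.End.mem_eigenspace_iff.1 hy
  refine ⟨v, ?_, complexCoord_injective ?_⟩
  · rintro rfl
    apply hy0
    funext a
    rcases a with i | i <;> apply Complex.ext <;> simp [complexCoord, cpart₁, cpart₂]
  · rw [complexCoord_mulVec, h1, complexCoord_mul_coe]

theorem SL.exists_hasGrowth [Nonempty ι] (g : SL ι)
    (hev : ∀ a, IsRightEigenvalue (mat g) a → ‖a‖ = 1) :
    ∃ (d : ℕ) (W : Submodule ℍᵐᵒᵖ (ι → ℍ)), W ≠ ⊤ ∧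
      HasGrowth atTop (fun (k : ℤ) v => (mat (g ^ k)).mulVec v)
        (fun k => ((k.natAbs : ℝ) + 1) ^ d) W ∧
      HasGrowth atBot (fun (k : ℤ) v => (mat (g ^ k)).mulVec v)
        (fun k => ((k.natAbs : ℝ) + 1) ^ d) W := by
  obtain ⟨d, W, hW, h1, h2⟩ := exists_hasGrowth_zpow
    (Units.map (complexifyHom ι) (g : Matrix.GeneralLinearGroup ι ℍ)) (fun μ hμ => by
      have := hev _ (isRightEigenvalue_of_hasEigenvalue hμ)
      rwa [norm_coeComplex] at this)
  have hT : ∀ (k : ℤ) (v : ι → ℍ), complexCoord ((mat (g ^ k)).mulVec v) =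
      (((Units.map (complexifyHom ι) (g : Matrix.GeneralLinearGroup ι ℍ)) ^ k :
        (Module.End ℂ (ι ⊕ ι → ℂ))ˣ) : Module.End ℂ (ι ⊕ ι → ℂ)) (complexCoord v) := by
    intro k v
    rw [← map_zpow, complexCoord_mulVec]
    rfl
  have g1 := HasGrowth.of_complexCoord hT h1
  have g2 := HasGrowth.of_complexCoord hT h2
  -- So far `W` is only a set of complex vectors; its growth characterization makes the preimage an
  -- `ℍ`-submodule.
  obtain ⟨W', hW'⟩ := g1.exists_submodule
  refine ⟨d, W', ?_, by rwa [hW'], by rwa [hW']⟩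
  rintro rfl
  apply hW
  rw [Submodule.top_coe] at hW'
  rw [Set.eq_univ_iff_forall]
  intro y
  obtain ⟨v, rfl⟩ := complexCoord_surjective y
  have : v ∈ complexCoord ⁻¹' W := hW' ▸ Set.mem_univ v
  exact this

/-- Parabolicity concerns some lift, which is `A` or `-A`, and a sign does not change the moduli of
eigenvalues. An empty block is excluded because its matrix is vacuously diagonal. -/
theorem IsParabolic.isRightEigenvalue {A : SL ι} (h : IsParabolic (PSL.mk A)) :
    Nonempty ι ∧ ∀ a, IsRightEigenvalue (mat A) a → ‖a‖ = 1 := by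
  obtain ⟨g, hg, hss, hev⟩ := h
  constructor
  · by_contra hne
    rw [not_nonempty_iff] at hne
    exact hss ⟨1, fun i => isEmptyElim i⟩
  · rintro a ⟨v, hv, hva⟩
    have h1 : mat (g⁻¹ * A) = 1 ∨ mat (g⁻¹ * A) = -1 := QuotientGroup.eq.1 hg
    have h2 : mat A = mat g * mat (g⁻¹ * A) := by rw [← mat_mul, mul_inv_cancel_left]
    rcases h1 with h1 | h1
    · rw [h1, mul_one] at h2
      exact hev a ⟨v, hv, h2 ▸ hva⟩
    · rw [h1, mul_neg, mul_one] at h2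
      rw [h2, Matrix.neg_mulVec] at hva
      have h3 : IsRightEigenvalue (mat g) (-a) := by
        refine ⟨v, hv, ?_⟩
        rw [← neg_neg ((mat g).mulVec v), hva]
        funext i
        simp
      simpa using hev _ h3

end Transfer

/-! ### Exponential rates against polynomial factors -/

section Domination

theorem tendsto_zpow_mul_natAbs_pow_atTop {q : ℝ} (hq0 : 0 < q) (hq : q < 1) (a : ℕ) :
    Tendsto (fun k : ℤ => q ^ k * ((k.natAbs : ℝ) + 1) ^ a) atTop (𝓝 0) := by
  rw [← Nat.map_cast_int_atTop, tendsto_map'_iff]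
  have h1 := (tendsto_add_atTop_iff_nat 1).2
    (tendsto_pow_const_mul_const_pow_of_lt_one a hq0.le hq)
  have h2 := h1.const_mul q⁻¹
  rw [mul_zero] at h2
  refine h2.congr fun n => ?_
  simp only [Function.comp, zpow_natCast, Int.natAbs_natCast, Nat.cast_add, Nat.cast_one]
  field_simp
  ring

theorem tendsto_zpow_mul_natAbs_pow_atBot {q : ℝ} (hq : 1 < q) (a : ℕ) :
    Tendsto (fun k : ℤ => q ^ k * ((k.natAbs : ℝ) + 1) ^ a) atBot (𝓝 0) := by
  have h1 := (tendsto_zpow_mul_natAbs_pow_atTop (inv_pos.2 (zero_lt_one.trans hq))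
    (inv_lt_one_of_one_lt₀ hq) a).comp tendsto_neg_atBot_atTop
  refine h1.congr fun k => ?_
  simp

/-- By `hdom` every other component is negligible against the rate of component `i₀`, so the total
growth is decided by `π i₀ v` alone. -/
theorem HasGrowth.of_dominant {κ : Type*} [Fintype κ] [DecidableEq κ] {E : Type*}
    [NormedAddCommGroup E] {F : κ → Type*} [∀ i, NormedAddCommGroup (F i)] {l : Filter ℤ}
    {T : ℤ → E → E} {R : ∀ i, ℤ → F i → F i} {π : ∀ i, E → F i} {r : κ → ℝ} (hr : ∀ i, 0 < r i)
    {d : κ → ℕ} {W : ∀ i, Set (F i)}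
    (h : ∀ i, HasGrowth l (R i) (fun k => ((k.natAbs : ℝ) + 1) ^ d i) (W i)) (i₀ : κ)
    (hle : ∀ k v, ‖T k v‖ ≤ ∑ i, r i ^ k * ‖R i k (π i v)‖)
    (hge : ∀ k v, r i₀ ^ k * ‖R i₀ k (π i₀ v)‖ ≤ ‖T k v‖)
    (hdom : ∀ i, i ≠ i₀ →
      Tendsto (fun k : ℤ => (r i / r i₀) ^ k * ((k.natAbs : ℝ) + 1) ^ d i) l (𝓝 0)) :
    HasGrowth l T (fun k => r i₀ ^ k * ((k.natAbs : ℝ) + 1) ^ d i₀) {v | π i₀ v ∈ W i₀} := by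
  have hpos : ∀ k : ℤ, 0 < r i₀ ^ k * ((k.natAbs : ℝ) + 1) ^ d i₀ := fun k =>
    mul_pos (zpow_pos (hr i₀) k) (by positivity)
  have hsmall : ∀ i, i ≠ i₀ → ∀ v, Tendsto (fun k : ℤ => r i ^ k * ‖R i k (π i v)‖ /
      (r i₀ ^ k * ((k.natAbs : ℝ) + 1) ^ d i₀)) l (𝓝 0) := by
    intro i hi v
    obtain ⟨C, hC⟩ := (h i).bounded (π i v)
    have h1 := (hdom i hi).const_mul |C|
    rw [mul_zero] at h1
    refine squeeze_zero' (Eventually.of_forall fun k => div_nonneg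
      (mul_nonneg (zpow_pos (hr i) k).le (norm_nonneg _)) (hpos k).le) ?_ h1
    filter_upwards [hC] with k hk
    have hk1 : (1 : ℝ) ≤ ((k.natAbs : ℝ) + 1) ^ d i₀ :=
      one_le_pow₀ (by linarith [Nat.cast_nonneg (α := ℝ) k.natAbs])
    have hk2 : ‖R i k (π i v)‖ ≤ |C| * ((k.natAbs : ℝ) + 1) ^ d i :=
      hk.trans (mul_le_mul_of_nonneg_right (le_abs_self C) (by positivity))
    have hz := zpow_pos (hr i) k
    have hz0 := zpow_pos (hr i₀) k
    rw [div_zpow]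
    calc r i ^ k * ‖R i k (π i v)‖ / (r i₀ ^ k * ((k.natAbs : ℝ) + 1) ^ d i₀)
        ≤ r i ^ k * ‖R i k (π i v)‖ / (r i₀ ^ k) := by
          refine div_le_div_of_nonneg_left (by positivity) hz0 ?_
          exact le_mul_of_one_le_right hz0.le hk1
      _ ≤ r i ^ k * (|C| * ((k.natAbs : ℝ) + 1) ^ d i) / (r i₀ ^ k) := by gcongr
      _ = _ := by ring
  refine ⟨hpos, fun v => ?_, fun v hv => ?_, fun v hv => ?_⟩
  · obtain ⟨C, hC⟩ := (h i₀).bounded (π i₀ v)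
    have h1 : ∀ᶠ k in l, ∀ i, i ≠ i₀ → r i ^ k * ‖R i k (π i v)‖ ≤
        r i₀ ^ k * ((k.natAbs : ℝ) + 1) ^ d i₀ := by
      rw [eventually_all]
      intro i
      by_cases hi : i = i₀
      · exact Eventually.of_forall fun k h => absurd hi h
      · filter_upwards [(hsmall i hi v).eventually (ge_mem_nhds zero_lt_one)] with k hk _
        simpa using (div_le_iff₀ (hpos k)).1 hk
    -- Component `i₀` contributes its own constant `C`; each other ratio tends to zero and is
    -- eventually at most `1`.
    refine ⟨∑ i, if i = i₀ then C else 1, ?_⟩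
    filter_upwards [hC, h1] with k hk1 hk2
    refine (hle k v).trans ?_
    rw [Finset.sum_mul]
    refine Finset.sum_le_sum fun i _ => ?_
    split_ifs with hi
    · subst hi
      calc _ ≤ r i ^ k * (C * ((k.natAbs : ℝ) + 1) ^ d i) :=
            mul_le_mul_of_nonneg_left hk1 (zpow_pos (hr i) k).le
        _ = _ := by ring
    · rw [one_mul]
      exact hk2 i hi
  · have h1 : ∀ i, Tendsto (fun k : ℤ => r i ^ k * ‖R i k (π i v)‖ /
        (r i₀ ^ k * ((k.natAbs : ℝ) + 1) ^ d i₀)) l (𝓝 0) := by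
      intro i
      by_cases hi : i = i₀
      · subst hi
        refine ((h i).small _ hv).congr fun k => ?_
        exact (mul_div_mul_left _ _ (zpow_pos (hr i) k).ne').symm
      · exact hsmall i hi v
    have h2 := tendsto_finsetSum Finset.univ fun i _ => h1 i
    rw [Finset.sum_const_zero] at h2
    refine squeeze_zero (fun k => div_nonneg (norm_nonneg _) (hpos k).le) (fun k => ?_) h2
    rw [← Finset.sum_div]
    exact div_le_div_of_nonneg_right (hle k v) (hpos k).le
  · obtain ⟨c, hc, hcv⟩ := (h i₀).large _ hv
    refine ⟨c, hc, hcv.mono fun k hk => le_trans ?_ (hge k v)⟩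
    calc _ = r i₀ ^ k * (c * ((k.natAbs : ℝ) + 1) ^ d i₀) := by ring
      _ ≤ _ := mul_le_mul_of_nonneg_left hk (zpow_pos (hr i₀) k).le

end Domination

/-! ### Block-diagonal powers and spans of coordinate points -/

section BlockDiagonal

variable {κ : Type*} [Fintype κ] [DecidableEq κ] {β : κ → Type*} [∀ i, Fintype (β i)]

/-- The coordinates of block `i`. -/
noncomputable def blockProj (i : κ) : ((Σ j, β j) → ℍ) →ₗ[ℍᵐᵒᵖ] (β i → ℍ) :=
  LinearMap.funLeft ℍᵐᵒᵖ ℍ (Sigma.mk i)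

theorem blockProj_blockIncl (i : κ) (w : β i → ℍ) : blockProj i (blockIncl i w) = w := by
  funext b
  simp [blockProj, blockIncl, LinearMap.funLeft]

theorem comap_blockProj_ne_top {i : κ} {W : Submodule ℍᵐᵒᵖ (β i → ℍ)} (hW : W ≠ ⊤) :
    W.comap (blockProj i) ≠ ⊤ := by
  intro h
  refine hW (Submodule.eq_top_iff'.2 fun w => ?_)
  have h1 : blockIncl i w ∈ W.comap (blockProj i) := h ▸ Submodule.mem_top
  rwa [Submodule.mem_comap, blockProj_blockIncl] at h1

theorem norm_le_sum_blockProj (v : (Σ j, β j) → ℍ) : ‖v‖ ≤ ∑ i, ‖blockProj i v‖ := by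
  rw [pi_norm_le_iff_of_nonneg (Finset.sum_nonneg fun i _ => norm_nonneg _)]
  rintro ⟨i, b⟩
  exact (norm_le_pi_norm (blockProj i v) b).trans
    (Finset.single_le_sum (f := fun i => ‖blockProj i v‖) (fun i _ => norm_nonneg _)
      (Finset.mem_univ i))

theorem norm_blockProj_le (v : (Σ j, β j) → ℍ) (i : κ) : ‖blockProj i v‖ ≤ ‖v‖ := by
  rw [pi_norm_le_iff_of_nonneg (norm_nonneg _)]
  exact fun b => norm_le_pi_norm v ⟨i, b⟩

theorem norm_mul_left (a : ℍ) {β : Type*} [Fintype β] (w : β → ℍ) :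
    ‖fun b => a * w b‖ = ‖a‖ * ‖w‖ := by
  have h : (fun b => a * w b) = a • w := rfl
  rw [h, norm_smul]

/-- A vector is its `i`-th block component plus a combination of the coordinate vectors of the other
blocks, and only the first summand is constrained by `W`. -/
theorem span_blockInclP_union [∀ i, DecidableEq (β i)] (i : κ)
    (W : Submodule ℍᵐᵒᵖ (β i → ℍ)) :
    Projectivization.Subspace.span
      (blockInclP (β := β) i '' (W.projectivization : Set (HP (β i))) ∪
        {x | ∃ p : Σ i, β i, p.1 ≠ i ∧ x = coordPoint p}) =
      (W.comap (blockProj i)).projectivization := by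
  refine le_antisymm ?_ ?_
  · rw [Projectivization.Subspace.span_le_subspace_iff]
    rintro x (⟨y, hy, rfl⟩ | ⟨p, hp, rfl⟩)
    · induction y using Projectivization.ind with | h w hw
      change blockIncl i w ∈ W.comap (blockProj i)
      rw [Submodule.mem_comap, blockProj_blockIncl]
      exact hy
    · change Pi.single p (1 : ℍ) ∈ W.comap (blockProj i)
      rw [Submodule.mem_comap]
      have : blockProj i (Pi.single p (1 : ℍ)) = 0 := by
        funext b
        have hne : (⟨i, b⟩ : Σ j, β j) ≠ p := fun h => hp (by rw [← h])
        simp [blockProj, LinearMap.funLeft, hne]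
      rw [this]
      exact W.zero_mem
  · set P := Projectivization.Subspace.span
      (blockInclP (β := β) i '' (W.projectivization : Set (HP (β i))) ∪
        {x | ∃ p : Σ i, β i, p.1 ≠ i ∧ x = coordPoint p}) with hP
    rw [← OrderIso.le_iff_le (Projectivization.Subspace.submodule), OrderIso.apply_symm_apply]
    intro v hv
    have hdec : v = blockIncl i (blockProj i v) +
        ∑ p : Σ j, β j, if p.1 = i then 0 else MulOpposite.op (v p) • Pi.single p (1 : ℍ) := by
      funext q
      rw [Pi.add_apply, Finset.sum_apply, Finset.sum_eq_single q]
      · obtain ⟨j, b⟩ := q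
        by_cases hj : j = i
        · subst hj
          simp [blockProj, blockIncl, LinearMap.funLeft]
        · simp [blockIncl, hj]
      · intro p _ hpq
        split_ifs
        · rfl
        · simp [hpq.symm]
      · simp
    rw [hdec]
    refine Submodule.add_mem _ ?_ (Submodule.sum_mem _ fun p _ => ?_)
    · intro h0
      have hw : blockProj i v ≠ 0 := fun h => h0 (by rw [h, map_zero])
      exact Projectivization.Subspace.subset_span _
        (Or.inl ⟨Projectivization.mk ℍᵐᵒᵖ (blockProj i v) hw, hv, rfl⟩)
    · split_ifs with hp
      · exact Submodule.zero_mem _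
      · refine Submodule.smul_mem _ _ fun h0 => ?_
        exact Projectivization.Subspace.subset_span _ (Or.inr ⟨p, hp, rfl⟩)

variable [∀ i, DecidableEq (β i)]

/-- As `lam i` commutes with the entries of `A i`, its powers can be moved to the left of `A i`, so
scalars and matrices are iterated separately. -/
theorem blockProj_zpow_mulVec {γ : SL (Σ i, β i)} {lam : κ → ℍ} (hlam : ∀ i, lam i ≠ 0)
    {A : ∀ i, SL (β i)} (hcomm : ∀ i p q, Commute (lam i) (mat (A i) p q))
    (hblock : mat γ = Matrix.blockDiagonal' fun i => lam i • mat (A i)) (k : ℤ)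
    (v : (Σ i, β i) → ℍ) (i : κ) :
    blockProj i ((mat (γ ^ k)).mulVec v) =
      fun b => lam i ^ k * (mat (A i ^ k)).mulVec (blockProj i v) b := by
  have hγ : ∀ (w : (Σ i, β i) → ℍ) (j : κ) (b : β j), (mat γ).mulVec w ⟨j, b⟩ =
      lam j * (mat (A j)).mulVec (blockProj j w) b := by
    intro w j b
    rw [hblock, Matrix.mulVec, dotProduct, Fintype.sum_sigma, Finset.sum_eq_single j]
    · simp only [Matrix.blockDiagonal'_apply_eq, Matrix.smul_apply, smul_eq_mul, Matrix.mulVec,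
        dotProduct, Finset.mul_sum, mul_assoc]
      rfl
    · intro j' _ hj'
      refine Finset.sum_eq_zero fun c _ => ?_
      rw [Matrix.blockDiagonal'_apply_ne _ _ _ hj'.symm, zero_mul]
    · simp
  let x : ℤ → (Σ i, β i) → ℍ := fun k p =>
    lam p.1 ^ k * (mat (A p.1 ^ k)).mulVec (blockProj p.1 v) p.2
  have hx : ∀ k, (mat γ).mulVec (x k) = x (k + 1) := by
    rintro k
    funext ⟨j, b⟩
    rw [hγ]
    have h1 : (mat (A j)).mulVec (blockProj j (x k)) b =
        lam j ^ k * (mat (A j)).mulVec ((mat (A j ^ k)).mulVec (blockProj j v)) b := by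
      rw [Matrix.mulVec, dotProduct, Matrix.mulVec, dotProduct, Finset.mul_sum]
      refine Finset.sum_congr rfl fun c _ => ?_
      rw [← mul_assoc, ((hcomm j b c).zpow_left₀ k).eq, mul_assoc]
      rfl
    simp only [x]
    rw [h1, Matrix.mulVec_mulVec, ← mat_mul, ← mul_assoc, add_comm k 1, zpow_add, zpow_one,
      zpow_add₀ (hlam j), zpow_one]
  have key : ∀ k : ℤ, (mat (γ ^ k)).mulVec v = x k := by
    intro k
    induction k using Int.induction_on with
    | zero =>
      funext ⟨j, b⟩
      simp [x, blockProj, LinearMap.funLeft]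
    | succ k ih => rw [add_comm, zpow_add, zpow_one, mat_mul, ← Matrix.mulVec_mulVec, ih, hx,
        add_comm]
    -- The inverse of `γ` is not computed: both sides have the same image under the injective map
    -- `γ`.
    | pred k ih =>
      apply mulVecLin_injective γ
      change (mat γ).mulVec _ = (mat γ).mulVec _
      rw [hx, Matrix.mulVec_mulVec, ← mat_mul, ← zpow_one_add, add_sub_cancel, ih, sub_add_cancel]
  rw [key]
  rfl

end BlockDiagonal

/-- The quaternionic norm is multiplicative, so block `i` of `γ ^ k v` has norm exactly `‖lam i‖ ^
k` times that of `A i ^ k` applied to block `i` of `v`, as domination requires. -/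
theorem hasLimitKernel_blockDiagonal {κ : Type*} [Fintype κ] [DecidableEq κ] {β : κ → Type*}
    [∀ i, Fintype (β i)] [∀ i, DecidableEq (β i)] {γ : SL (Σ i, β i)} {lam : κ → ℍ}
    (hlam : ∀ i, lam i ≠ 0) {A : ∀ i, SL (β i)}
    (hcomm : ∀ i p q, Commute (lam i) (mat (A i) p q))
    (hblock : mat γ = Matrix.blockDiagonal' fun i => lam i • mat (A i)) {l : Filter ℤ} {d : κ → ℕ}
    {W : ∀ i, Submodule ℍᵐᵒᵖ (β i → ℍ)} (hW : ∀ i, W i ≠ ⊤)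
    (h : ∀ i, HasGrowth l (fun (k : ℤ) v => (mat (A i ^ k)).mulVec v)
      (fun k => ((k.natAbs : ℝ) + 1) ^ d i) (W i)) (i₀ : κ)
    (hdom : ∀ i, i ≠ i₀ → Tendsto
      (fun k : ℤ => (‖lam i‖ / ‖lam i₀‖) ^ k * ((k.natAbs : ℝ) + 1) ^ d i) l (𝓝 0)) :
    HasLimitKernel l (fun k => mat (γ ^ k)) ((W i₀).comap (blockProj i₀)) := by
  have hnorm : ∀ (k : ℤ) (v : (Σ i, β i) → ℍ) (i : κ),
      ‖blockProj i ((mat (γ ^ k)).mulVec v)‖ =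
        ‖lam i‖ ^ k * ‖(mat (A i ^ k)).mulVec (blockProj i v)‖ := by
    intro k v i
    rw [blockProj_zpow_mulVec hlam hcomm hblock, norm_mul_left, norm_zpow]
  refine HasGrowth.hasLimitKernel (comap_blockProj_ne_top (hW i₀))
    (HasGrowth.of_dominant (π := fun i v => blockProj i v) (fun i => norm_pos_iff.2 (hlam i)) h i₀
      (fun k v => ?_) (fun k v => ?_) hdom)
  · simp only [← hnorm]
    exact norm_le_sum_blockProj _
  · rw [← hnorm]
    exact norm_blockProj_le _ _

theorem ne_zero_of_blockDiagonal {κ : Type*} [Fintype κ] [DecidableEq κ] {β : κ → Type*}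
    [∀ i, Fintype (β i)] [∀ i, DecidableEq (β i)] {γ : SL (Σ i, β i)} {lam : κ → ℍ}
    {A : ∀ i, SL (β i)} (hblock : mat γ = Matrix.blockDiagonal' fun i => lam i • mat (A i))
    {i : κ} (b : β i) : lam i ≠ 0 := by
  intro h0
  have hne : (Pi.single (⟨i, b⟩ : Σ i, β i) (1 : ℍ) : (Σ i, β i) → ℍ) ≠ 0 := by simp
  refine SL.mulVec_ne_zero γ hne ?_
  funext ⟨j, c⟩
  rw [hblock, Matrix.mulVec_single_one, Matrix.col_apply, Matrix.blockDiagonal'_apply]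
  split_ifs with hj
  · change j = i at hj
    subst hj
    simp [h0]
  · rfl

end QuatProj

theorem mainTheorem6 (k : ℕ) (m : Fin (k + 1) → ℕ)
    (γ : QuatProj.SL (Σ i, Fin (m i)))
    (lam : Fin (k + 1) → ℍ)
    (A : ∀ i, QuatProj.SL (Fin (m i)))
    (hγ : QuatProj.IsLoxoparabolic (QuatProj.PSL.mk γ))
    (hA : ∀ i, QuatProj.IsParabolic (QuatProj.PSL.mk (A i)))
    (hcomm : ∀ i p q, Commute (lam i) (QuatProj.mat (A i) p q))
    (hlam : StrictMono fun i => ‖lam i‖)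
    (hblock : QuatProj.mat γ = Matrix.blockDiagonal' fun i => lam i • QuatProj.mat (A i)) :
    (QuatProj.eqRegion (Subgroup.zpowers (QuatProj.PSL.mk γ)))ᶜ =
      (Projectivization.Subspace.span
        (QuatProj.blockInclP (β := fun i => Fin (m i)) 0 ''
            (QuatProj.eqRegion (Subgroup.zpowers (QuatProj.PSL.mk (A 0))))ᶜ ∪
          {x | ∃ p : Σ i, Fin (m i), p.1 ≠ 0 ∧ x = QuatProj.coordPoint p}) :
        Set (QuatProj.HP (Σ i, Fin (m i)))) ∪
      (Projectivization.Subspace.span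
        ({x | ∃ p : Σ i, Fin (m i), p.1 ≠ Fin.last k ∧ x = QuatProj.coordPoint p} ∪
          QuatProj.blockInclP (β := fun i => Fin (m i)) (Fin.last k) ''
            (QuatProj.eqRegion (Subgroup.zpowers (QuatProj.PSL.mk (A (Fin.last k)))))ᶜ) :
        Set (QuatProj.HP (Σ i, Fin (m i)))) := by
  have hpar := fun i => (hA i).isRightEigenvalue
  have hne : ∀ i, lam i ≠ 0 := fun i =>
    QuatProj.ne_zero_of_blockDiagonal hblock (hpar i).1.some
  have hgrow := fun i =>
    have := (hpar i).1
    QuatProj.SL.exists_hasGrowth (A i) (hpar i).2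
  choose d W hW htop hbot using hgrow
  have hpos : ∀ i, 0 < ‖lam i‖ := fun i => norm_pos_iff.2 (hne i)
  -- For `k → -∞` the smallest modulus dominates: the ratios `‖lam i‖ / ‖lam 0‖` exceed `1` and
  -- their powers decay.
  have h₁ := QuatProj.hasLimitKernel_blockDiagonal hne hcomm hblock hW hbot 0 fun i hi =>
    QuatProj.tendsto_zpow_mul_natAbs_pow_atBot
      ((one_lt_div (hpos 0)).2 (hlam (Fin.pos_iff_ne_zero.2 hi))) (d i)
  have h₂ := QuatProj.hasLimitKernel_blockDiagonal hne hcomm hblock hW htop (Fin.last k)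
    fun i hi => QuatProj.tendsto_zpow_mul_natAbs_pow_atTop (div_pos (hpos i) (hpos _))
      ((div_lt_one (hpos _)).2 (hlam (Fin.lt_last_iff_ne_last.2 hi))) (d i)
  -- For a single parabolic block both directions have the same kernel, so the union of two
  -- subspaces collapses to one.
  have hΛ : ∀ i, (QuatProj.eqRegion (Subgroup.zpowers (QuatProj.PSL.mk (A i))))ᶜ =
      ((W i).projectivization : Set (QuatProj.HP (Fin (m i)))) := by
    intro i
    rw [QuatProj.eqRegion_zpowers_compl ((hbot i).hasLimitKernel (hW i))
      ((htop i).hasLimitKernel (hW i)), Set.union_self]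
  rw [QuatProj.eqRegion_zpowers_compl h₁ h₂, hΛ, hΛ, QuatProj.span_blockInclP_union,
    Set.union_comm {x | ∃ p : Σ i, Fin (m i), p.1 ≠ Fin.last k ∧ x = QuatProj.coordPoint p},
    QuatProj.span_blockInclP_union]
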